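/- Let $H^2$ be the Hardy space on the open unit disk $\mathbb D$, let $H^\infty$ be the algebra of bounded analytic functions in $\mathbb D$, and let $S$ be the unilateral shift on $H^2$, i.e. multiplication by the independent variable. A bounded operator $X$ between Hilbert spaces is a quasiaffinity if $\ker X=\{0\}$ and $X$ has dense range. For operators $T$ and $R$, write $T\prec R$ if there is a quasiaffinity $X$ with $XT=RX$, and $T\sim R$ (quasisimilarity) if $T\prec R$ and $R\prec T$. Let $\theta\in H^\infty$ be an inner function, $\mathcal K_\theta=H^2\ominus\theta H^2$, $T_\theta=P_{\mathcal K_\theta}S|_{\mathcal K_\theta}$ and $K_\theta=P_{\theta H^2}S|_{\mathcal K_\theta}$, where $P_{\mathcal M}$ is the orthogonal projection onto $\mathcal M$. Let $\mathcal H$ be a complex Hilbert space and let $T_0\colon\mathcal H\to\mathcal H$, $Y_0\colon\mathcal H\to\mathcal K_\theta$, $Z\colon\mathcal H\to\theta H^2$ be bounded linear operators such that $Y_0T_0=T_\theta Y_0$ and $Y_0$ is a quasiaffinity. Put $A=S|_{\theta H^2}Z-ZT_0+K_\theta Y_0$ and $$T=\begin{pmatrix} S|_{\theta H^2} & A\\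 \mathbb O & T_0\end{pmatrix}\quad\text{on }\theta H^2\oplus\mathcal H .$$ Then $T\sim S$ if and only if there exist a quasiaffinity $X_0\colon\mathcal K_\theta\to\mathcal H$ and an outer function $g\in H^\infty$ such that $T_0X_0=X_0T_\theta$ and $Y_0X_0=g(T_\theta)$, where $g(T_\theta)$ is given by the $H^\infty$-functional calculus of the contraction $T_\theta$. -/

import Mathlib

noncomputable section

open Filter Topology MeasureTheory Metric

/-- The Hardy space `H²` of the unit disk. An element is recorded by its square-summable sequence of
Taylor coefficients at the origin; the analytic function itself is `hardyEval`. -/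
abbrev Hardy2 : Type := lp (fun _ : ℕ => ℂ) 2

/-- The value at `z ∈ 𝔻` of the analytic function `f ∈ H²`. -/
def hardyEval (f : Hardy2) (z : ℂ) : ℂ := ∑' n, f n * z ^ n

theorem hardy_hasSum_sq (f : Hardy2) : HasSum (fun n => ‖f n‖ ^ 2) (‖f‖ ^ 2) := by
  simpa using lp.hasSum_norm (p := 2) (by norm_num) f

theorem hardy_memlp {a : ℕ → ℂ} (h : Summable fun n => ‖a n‖ ^ 2) :
    Memℓp (E := fun _ : ℕ => ℂ) a 2 :=
  memℓp_gen (by simpa using h)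

theorem hardy_coeff_le (f : Hardy2) (n : ℕ) : ‖f n‖ ≤ ‖f‖ :=
  lp.norm_apply_le_norm (by norm_num) f n

theorem hardy_summable_norm (f : Hardy2) {r : ℝ} (h0 : 0 ≤ r) (h1 : r < 1) :
    Summable fun n => ‖f n‖ * r ^ n :=
  Summable.of_nonneg_of_le (fun n => by positivity)
    (fun n => mul_le_mul_of_nonneg_right (hardy_coeff_le f n) (by positivity))
    ((summable_geometric_of_lt_one h0 h1).mul_left ‖f‖)

theorem hardy_summable (f : Hardy2) {z : ℂ} (hz : ‖z‖ < 1) : Summable fun n => f n * z ^ n := by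
  refine Summable.of_norm ?_
  simpa using hardy_summable_norm f (norm_nonneg z) hz

theorem hardyEval_add (f g : Hardy2) {z : ℂ} (hz : ‖z‖ < 1) :
    hardyEval (f + g) z = hardyEval f z + hardyEval g z := by
  simp only [hardyEval, lp.coeFn_add, Pi.add_apply, add_mul]
  exact (hardy_summable f hz).tsum_add (hardy_summable g hz)

theorem hardyEval_smul (c : ℂ) (f : Hardy2) (z : ℂ) :
    hardyEval (c • f) z = c * hardyEval f z := by
  simp only [hardyEval, lp.coeFn_smul, Pi.smul_apply, smul_eq_mul, mul_assoc, tsum_mul_left]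

theorem hardyEval_sub (f g : Hardy2) {z : ℂ} (hz : ‖z‖ < 1) :
    hardyEval (f - g) z = hardyEval f z - hardyEval g z := by
  have := hardyEval_add (f - g) g hz
  rw [sub_add_cancel] at this
  rw [this]; ring

theorem hardyEval_norm_le (f : Hardy2) {z : ℂ} (hz : ‖z‖ < 1) :
    ‖hardyEval f z‖ ≤ ‖f‖ * (1 - ‖z‖)⁻¹ := by
  rw [← tsum_geometric_of_lt_one (norm_nonneg z) hz, ← tsum_mul_left]
  refine tsum_of_norm_bounded
    ((summable_geometric_of_lt_one (norm_nonneg z) hz).mul_left ‖f‖).hasSum fun n => ?_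
  rw [norm_mul, norm_pow]
  exact mul_le_mul_of_nonneg_right (hardy_coeff_le f n) (by positivity)

theorem hardyEval_tendsto {u : ℕ → Hardy2} {f : Hardy2} (hu : Tendsto u atTop (𝓝 f)) {z : ℂ}
    (hz : ‖z‖ < 1) : Tendsto (fun k => hardyEval (u k) z) atTop (𝓝 (hardyEval f z)) := by
  rw [tendsto_iff_norm_sub_tendsto_zero] at hu ⊢
  refine squeeze_zero (fun _ => norm_nonneg _) (fun k => ?_)
    (by simpa using hu.mul_const (1 - ‖z‖)⁻¹)
  rw [← hardyEval_sub _ _ hz]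
  exact hardyEval_norm_le _ hz

theorem hardy_shift_mem (f : Hardy2) :
    Memℓp (E := fun _ : ℕ => ℂ) (fun n => if n = 0 then 0 else f (n - 1)) 2 :=
  hardy_memlp ((summable_nat_add_iff 1).1 (by simpa using (hardy_hasSum_sq f).summable))

/-- The shift of the Taylor coefficients: `a₀, a₁, … ↦ 0, a₀, a₁, …`. -/
def hardyShiftLinear : Hardy2 →ₗ[ℂ] Hardy2 where
  toFun f := ⟨fun n => if n = 0 then 0 else f (n - 1), hardy_shift_mem f⟩
  map_add' f g := by
    refine lp.ext (funext fun n => ?_)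
    by_cases h : n = 0
    · subst h; exact (add_zero (0 : ℂ)).symm
    · change (if n = 0 then (0 : ℂ) else f (n - 1) + g (n - 1)) =
        (if n = 0 then 0 else f (n - 1)) + (if n = 0 then 0 else g (n - 1))
      simp [h]
  map_smul' c f := by
    refine lp.ext (funext fun n => ?_)
    by_cases h : n = 0 <;> simp [h]

theorem hardyShiftLinear_norm (f : Hardy2) : ‖hardyShiftLinear f‖ = ‖f‖ := by
  refine (sq_eq_sq₀ (norm_nonneg _) (norm_nonneg _)).1 ?_
  rw [← (hardy_hasSum_sq (hardyShiftLinear f)).tsum_eq, ← (hardy_hasSum_sq f).tsum_eq,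
    (hardy_hasSum_sq (hardyShiftLinear f)).summable.tsum_eq_zero_add]
  simp [hardyShiftLinear]

/-- The unilateral shift `S` on `H²`: multiplication by the independent variable, see
`hardyEval_shift`. -/
def hardyShift : Hardy2 →L[ℂ] Hardy2 :=
  hardyShiftLinear.mkContinuous 1 fun f => by rw [hardyShiftLinear_norm, one_mul]

theorem hardyShift_zero (f : Hardy2) : hardyShift f 0 = 0 := rfl

theorem hardyShift_succ (f : Hardy2) (n : ℕ) : hardyShift f (n + 1) = f n := rfl

theorem hardyEval_shift (f : Hardy2) {z : ℂ} (hz : ‖z‖ < 1) :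
    hardyEval (hardyShift f) z = z * hardyEval f z := by
  rw [hardyEval, (hardy_summable _ hz).tsum_eq_zero_add, hardyEval, ← tsum_mul_left]
  simp only [hardyShift_zero, hardyShift_succ, zero_mul, zero_add]
  exact tsum_congr fun n => by ring

/-- Parseval's identity on the circle of radius `r`. -/
theorem hardy_parseval {a : ℕ → ℂ} {r : ℝ} (hr : 0 ≤ r) (ha : Summable fun n => ‖a n‖ * r ^ n) :
    HasSum (fun n => (‖a n‖ * r ^ n) ^ 2)
      ((2 * Real.pi)⁻¹ * ∫ t in (0 : ℝ)..2 * Real.pi, ‖∑' n, a n * circleMap 0 r t ^ n‖ ^ 2) := by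
  have : Fact (0 < 2 * Real.pi) := ⟨Real.two_pi_pos⟩
  have hs : Summable fun n : ℕ => (a n * (r : ℂ) ^ n) • fourier (T := 2 * Real.pi) (n : ℤ) := by
    refine Summable.of_norm ?_
    simpa [norm_smul, fourier_norm, abs_of_nonneg hr] using ha
  obtain ⟨G, hG⟩ := hs
  have hGx : ∀ t : ℝ, G (t : AddCircle (2 * Real.pi)) = ∑' n, a n * circleMap 0 r t ^ n := by
    intro t
    have := (hG.map (ContinuousMap.evalCLM ℂ (t : AddCircle (2 * Real.pi)))
      (ContinuousLinearMap.continuous _)).tsum_eq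
    rw [ContinuousMap.evalCLM_apply] at this
    rw [← this]
    refine tsum_congr fun n => ?_
    simp only [Function.comp, ContinuousMap.evalCLM_apply, ContinuousMap.smul_apply, smul_eq_mul,
      fourier_coe_apply, circleMap, zero_add, mul_pow, ← Complex.exp_nat_mul, mul_assoc]
    congr 3
    push_cast
    field_simp
  set L := ContinuousMap.toLp (E := ℂ) 2 (AddCircle.haarAddCircle (T := 2 * Real.pi)) ℂ with hL
  have hGL : HasSum (fun n : ℕ => (a n * (r : ℂ) ^ n) • fourierLp (T := 2 * Real.pi) 2 (n : ℤ))
      (L G) := by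
    have := hG.map L L.continuous
    simpa only [Function.comp_def, map_smul] using this
  have hc : ∀ k : ℤ, fourierCoeff (L G : AddCircle (2 * Real.pi) → ℂ) k =
      if 0 ≤ k then a k.toNat * (r : ℂ) ^ k.toNat else 0 := by
    intro k
    rw [← fourierBasis_repr, HilbertBasis.repr_apply_apply, coe_fourierBasis]
    have h1 := (hGL.mapL (innerSL ℂ (fourierLp (T := 2 * Real.pi) 2 k))).tsum_eq
    rw [innerSL_apply_apply] at h1
    rw [← h1]
    have ho := orthonormal_iff_ite.1 (orthonormal_fourier (T := 2 * Real.pi))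
    simp only [map_smul, innerSL_apply_apply, ho, smul_eq_mul, mul_ite, mul_one, mul_zero]
    split_ifs with hk
    · rw [tsum_eq_single k.toNat]
      · simp [hk]
      · intro n hn
        rw [if_neg]
        omega
    · refine (tsum_congr fun n => ?_).trans tsum_zero
      rw [if_neg (by intro h; exact hk (by omega))]
  have hP := hasSum_sq_fourierCoeff (L G)
  simp only [hc] at hP
  have hI : (∫ t, ‖(L G : AddCircle (2 * Real.pi) → ℂ) t‖ ^ 2 ∂AddCircle.haarAddCircle) =
      (2 * Real.pi)⁻¹ * ∫ t in (0 : ℝ)..2 * Real.pi, ‖∑' n, a n * circleMap 0 r t ^ n‖ ^ 2 := by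
    have h2 : (∫ t, ‖(L G : AddCircle (2 * Real.pi) → ℂ) t‖ ^ 2 ∂AddCircle.haarAddCircle) =
        ∫ t, ‖G t‖ ^ 2 ∂AddCircle.haarAddCircle (T := 2 * Real.pi) := by
      refine integral_congr_ae ?_
      filter_upwards [ContinuousMap.coeFn_toLp (p := 2) (𝕜 := ℂ)
        (AddCircle.haarAddCircle (T := 2 * Real.pi)) G] with t ht
      rw [ht]
    rw [h2, AddCircle.integral_haarAddCircle, smul_eq_mul,
      ← AddCircle.intervalIntegral_preimage (2 * Real.pi) 0]
    simp only [hGx, zero_add]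
  rw [hI] at hP
  rw [← (Nat.cast_injective (R := ℤ)).hasSum_iff] at hP
  · convert hP using 2 with n
    simp [abs_of_nonneg hr]
  · intro k hk
    have : ¬ 0 ≤ k := fun h => hk ⟨k.toNat, by simp [h]⟩
    simp [this]


/-- Membership in `H^∞`: bounded and analytic in the open unit disk. -/
def IsHInfty (φ : ℂ → ℂ) : Prop :=
  DifferentiableOn ℂ φ (ball 0 1) ∧ ∃ C : ℝ, ∀ z ∈ ball (0 : ℂ) 1, ‖φ z‖ ≤ C

/-- Inner functions: `θ ∈ H^∞` whose radial limits exist and are unimodular at almost every point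
`e^{it}` of the unit circle. -/
def IsInner (θ : ℂ → ℂ) : Prop :=
  IsHInfty θ ∧ ∀ᵐ t : ℝ, ∃ w : ℂ, ‖w‖ = 1 ∧
    Tendsto (fun r : ℝ => θ (circleMap 0 r t)) (𝓝[<] 1) (𝓝 w)

/-- Outer functions: `g(z) = c exp ((2π)⁻¹ ∫ (ζ + z) / (ζ - z) u(ζ) |dζ|)` for all `z ∈ 𝔻`, with
a unimodular constant `c` and a real `u ∈ L¹` on the unit circle. -/
def IsOuter (g : ℂ → ℂ) : Prop :=
  ∃ (c : ℂ) (u : ℂ → ℝ), ‖c‖ = 1 ∧ CircleIntegrable u 0 1 ∧ ∀ z ∈ ball (0 : ℂ) 1,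
    g z = c * Complex.exp (Real.circleAverage (fun ζ => (ζ + z) / (ζ - z) * (u ζ : ℂ)) 0 1)

theorem circleMap_mem_disk {r : ℝ} (h0 : 0 ≤ r) (h1 : r < 1) (t : ℝ) :
    ‖circleMap 0 r t‖ < 1 := by
  simpa [abs_of_nonneg h0] using h1

/-- The subspace `θH²` of `H²`. -/
def innerRange (θ : ℂ → ℂ) : Submodule ℂ Hardy2 where
  carrier := {h | ∃ f : Hardy2, ∀ z ∈ ball (0 : ℂ) 1, hardyEval h z = θ z * hardyEval f z}
  add_mem' := by
    rintro h k ⟨f, hf⟩ ⟨g, hg⟩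
    refine ⟨f + g, fun z hz => ?_⟩
    have hz' : ‖z‖ < 1 := by simpa using hz
    rw [hardyEval_add _ _ hz', hardyEval_add _ _ hz', hf z hz, hg z hz, mul_add]
  zero_mem' := ⟨0, fun z _ => by simp [hardyEval]⟩
  smul_mem' := by
    rintro c h ⟨f, hf⟩
    refine ⟨c • f, fun z hz => ?_⟩
    rw [hardyEval_smul, hardyEval_smul, hf z hz]
    ring

theorem hardy_mean (f : Hardy2) {r : ℝ} (h0 : 0 ≤ r) (h1 : r < 1) :
    HasSum (fun n => (‖f n‖ * r ^ n) ^ 2)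
      ((2 * Real.pi)⁻¹ * ∫ t in (0 : ℝ)..2 * Real.pi, ‖hardyEval f (circleMap 0 r t)‖ ^ 2) :=
  hardy_parseval h0 (hardy_summable_norm f h0 h1)

theorem hardyEval_continuousOn (f : Hardy2) {r : ℝ} (h0 : 0 ≤ r) (h1 : r < 1) :
    Continuous fun t : ℝ => hardyEval f (circleMap 0 r t) := by
  refine continuous_tsum (fun n => by fun_prop) (hardy_summable_norm f h0 h1) fun n t => ?_
  simp [abs_of_nonneg h0]

theorem hardy_mul_norm_le {θ : ℂ → ℂ} {C : ℝ} (hC : ∀ z ∈ ball (0 : ℂ) 1, ‖θ z‖ ≤ C)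
    {h f : Hardy2} (hf : ∀ z ∈ ball (0 : ℂ) 1, hardyEval h z = θ z * hardyEval f z) :
    ‖h‖ ≤ C * ‖f‖ := by
  have hC0 : 0 ≤ C := (norm_nonneg _).trans (hC 0 (by simp))
  have key : ∀ r : ℝ, 0 ≤ r → r < 1 → ∀ s : Finset ℕ,
      ∑ n ∈ s, (‖h n‖ * r ^ n) ^ 2 ≤ (C * ‖f‖) ^ 2 := by
    intro r h0 h1 s
    refine (sum_le_hasSum s (fun n _ => sq_nonneg (‖h n‖ * r ^ n)) (hardy_mean h h0 h1)).trans ?_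
    have h2 : ((2 * Real.pi)⁻¹ * ∫ t in (0 : ℝ)..2 * Real.pi,
        ‖hardyEval h (circleMap 0 r t)‖ ^ 2) ≤ C ^ 2 * ((2 * Real.pi)⁻¹ *
        ∫ t in (0 : ℝ)..2 * Real.pi, ‖hardyEval f (circleMap 0 r t)‖ ^ 2) := by
      rw [mul_left_comm]
      refine mul_le_mul_of_nonneg_left ?_ (inv_nonneg.2 Real.two_pi_pos.le)
      rw [← intervalIntegral.integral_const_mul]
      refine intervalIntegral.integral_mono_on Real.two_pi_pos.le
        (((hardyEval_continuousOn h h0 h1).norm.pow 2).intervalIntegrable _ _)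
        ((((hardyEval_continuousOn f h0 h1).norm.pow 2).const_mul (C ^ 2)).intervalIntegrable _ _)
        fun t _ => ?_
      have hm : circleMap 0 r t ∈ ball (0 : ℂ) 1 := by
        simpa using circleMap_mem_disk h0 h1 t
      rw [hf _ hm, norm_mul, mul_pow]
      have := hC _ hm
      gcongr
    refine h2.trans ?_
    rw [mul_pow]
    refine mul_le_mul_of_nonneg_left ?_ (by positivity)
    refine hasSum_le (fun n => ?_) (hardy_mean f h0 h1) (hardy_hasSum_sq f)
    have : r ^ n ≤ 1 := pow_le_one₀ h0 h1.le
    have : ‖f n‖ * r ^ n ≤ ‖f n‖ := mul_le_of_le_one_right (norm_nonneg _) this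
    gcongr
  refine (sq_le_sq₀ (norm_nonneg _) (by positivity)).1 ?_
  refine hasSum_le_of_sum_le (hardy_hasSum_sq h) fun s => ?_
  have ht : Tendsto (fun r : ℝ => ∑ n ∈ s, (‖h n‖ * r ^ n) ^ 2) (𝓝[<] 1)
      (𝓝 (∑ n ∈ s, ‖h n‖ ^ 2)) := by
    have hc : Continuous fun r : ℝ => ∑ n ∈ s, (‖h n‖ * r ^ n) ^ 2 := by fun_prop
    simpa using (hc.tendsto 1).mono_left nhdsWithin_le_nhds
  refine le_of_tendsto ht ?_
  filter_upwards [Ioo_mem_nhdsLT (zero_lt_one (α := ℝ))] with r hr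
  exact key r hr.1.le hr.2 s

/-- Bounded analytic functions lie in `H²`. -/
theorem hardy_of_isHInfty {F : ℂ → ℂ} (hF : IsHInfty F) :
    ∃ h : Hardy2, ∀ z ∈ ball (0 : ℂ) 1, hardyEval h z = F z := by
  obtain ⟨hd, C, hC⟩ := hF
  have hC0 : 0 ≤ C := (norm_nonneg _).trans (hC 0 (by simp))
  set a : ℕ → ℂ := fun n => (n.factorial : ℂ)⁻¹ * iteratedDeriv n F 0 with ha
  have hs : ∀ z ∈ ball (0 : ℂ) 1, HasSum (fun n => a n * z ^ n) (F z) := by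
    intro z hz
    have := Complex.hasSum_taylorSeries_on_ball hd hz
    have he : (fun n => a n * z ^ n) =
        fun n : ℕ => (n.factorial : ℂ)⁻¹ • (z - 0) ^ n • iteratedDeriv n F 0 := by
      funext n
      simp only [ha, sub_zero, smul_eq_mul]
      ring
    rw [he]
    exact this
  have hsn : ∀ r : ℝ, 0 ≤ r → r < 1 → Summable fun n => ‖a n‖ * r ^ n := by
    intro r h0 h1
    have := (hs (r : ℂ) (by simpa [abs_of_nonneg h0] using h1)).summable.norm
    simpa [abs_of_nonneg h0] using this
  have key : ∀ r : ℝ, 0 ≤ r → r < 1 → ∀ s : Finset ℕ,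
      ∑ n ∈ s, (‖a n‖ * r ^ n) ^ 2 ≤ C ^ 2 := by
    intro r h0 h1 s
    refine (sum_le_hasSum s (fun n _ => sq_nonneg _) (hardy_parseval h0 (hsn r h0 h1))).trans ?_
    have h2 : ‖∫ t in (0 : ℝ)..2 * Real.pi, ‖∑' n, a n * circleMap 0 r t ^ n‖ ^ 2‖ ≤
        C ^ 2 * |2 * Real.pi - 0| := by
      refine intervalIntegral.norm_integral_le_of_norm_le_const fun t _ => ?_
      have hm : circleMap 0 r t ∈ ball (0 : ℂ) 1 := by
        simpa using circleMap_mem_disk h0 h1 t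
      rw [(hs _ hm).tsum_eq, norm_pow, norm_norm]
      have := hC _ hm
      gcongr
    rw [sub_zero, abs_of_pos Real.two_pi_pos] at h2
    have h3 := (le_abs_self _).trans h2
    rw [inv_mul_le_iff₀ Real.two_pi_pos]
    linarith
  have hsum : Summable fun n => ‖a n‖ ^ 2 := by
    refine summable_of_sum_le (c := C ^ 2) (fun n => sq_nonneg _) fun s => ?_
    have ht : Tendsto (fun r : ℝ => ∑ n ∈ s, (‖a n‖ * r ^ n) ^ 2) (𝓝[<] 1)
        (𝓝 (∑ n ∈ s, ‖a n‖ ^ 2)) := by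
      have hc : Continuous fun r : ℝ => ∑ n ∈ s, (‖a n‖ * r ^ n) ^ 2 := by fun_prop
      simpa using (hc.tendsto 1).mono_left nhdsWithin_le_nhds
    refine le_of_tendsto ht ?_
    filter_upwards [Ioo_mem_nhdsLT (zero_lt_one (α := ℝ))] with r hr
    exact key r hr.1.le hr.2 s
  exact ⟨⟨a, hardy_memlp hsum⟩, fun z hz => (hs z hz).tsum_eq⟩

theorem hardy_mean_tendsto (f : Hardy2) :
    Tendsto (fun r : ℝ => (2 * Real.pi)⁻¹ *
      ∫ t in (0 : ℝ)..2 * Real.pi, ‖hardyEval f (circleMap 0 r t)‖ ^ 2) (𝓝[<] 1)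
      (𝓝 (‖f‖ ^ 2)) := by
  have h1 : Tendsto (fun r : ℝ => ∑' n, (‖f n‖ * r ^ n) ^ 2) (𝓝[<] 1) (𝓝 (∑' n, ‖f n‖ ^ 2)) := by
    refine tendsto_tsum_of_dominated_convergence (hardy_hasSum_sq f).summable (fun n => ?_) ?_
    · have hc : Continuous fun r : ℝ => (‖f n‖ * r ^ n) ^ 2 := by fun_prop
      simpa using (hc.tendsto 1).mono_left nhdsWithin_le_nhds
    · filter_upwards [Ioo_mem_nhdsLT (zero_lt_one (α := ℝ))] with r hr n
      have : r ^ n ≤ 1 := pow_le_one₀ hr.1.le hr.2.le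
      have h3 : ‖f n‖ * r ^ n ≤ ‖f n‖ := mul_le_of_le_one_right (norm_nonneg _) this
      have h4 : 0 ≤ ‖f n‖ * r ^ n := mul_nonneg (norm_nonneg _) (pow_nonneg hr.1.le _)
      rw [norm_pow, Real.norm_of_nonneg h4]
      gcongr
  rw [(hardy_hasSum_sq f).tsum_eq] at h1
  refine h1.congr' ?_
  filter_upwards [Ioo_mem_nhdsLT (zero_lt_one (α := ℝ))] with r hr
  exact (hardy_mean f hr.1.le hr.2).tsum_eq

theorem hardy_mul_poly {θ : ℂ → ℂ} (hθ : IsInner θ) (p : Hardy2) (s : Finset ℕ)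
    (hp : ∀ n ∉ s, p n = 0) :
    ∃ h : Hardy2, (∀ z ∈ ball (0 : ℂ) 1, hardyEval h z = θ z * hardyEval p z) ∧ ‖h‖ = ‖p‖ := by
  obtain ⟨⟨hd, C, hC⟩, hlim⟩ := hθ
  have hC0 : 0 ≤ C := (norm_nonneg _).trans (hC 0 (by simp))
  have hpe : hardyEval p = fun z => ∑ n ∈ s, p n * z ^ n := by
    funext z
    exact tsum_eq_sum fun n hn => by simp [hp n hn]
  have hpc : Continuous (hardyEval p) := by rw [hpe]; fun_prop
  have hpd : Differentiable ℂ (hardyEval p) := by rw [hpe]; fun_prop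
  obtain ⟨B, hB⟩ := (isCompact_closedBall (0 : ℂ) 1).exists_bound_of_continuousOn
    hpc.continuousOn
  have hB0 : 0 ≤ B := (norm_nonneg _).trans (hB 0 (by simp))
  have hbd : ∀ z ∈ ball (0 : ℂ) 1, ‖θ z * hardyEval p z‖ ≤ C * B := fun z hz => by
    rw [norm_mul]
    exact mul_le_mul (hC z hz) (hB z (ball_subset_closedBall hz)) (norm_nonneg _) hC0
  obtain ⟨h, hh⟩ := hardy_of_isHInfty (F := fun z => θ z * hardyEval p z)
    ⟨hd.mul hpd.differentiableOn, C * B, hbd⟩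
  refine ⟨h, hh, ?_⟩
  have hP1 := hardy_parseval (a := p) (r := 1) zero_le_one
    (summable_of_ne_finset_zero (s := s) fun n hn => by simp [hp n hn])
  have hP2 : ‖p‖ ^ 2 = (2 * Real.pi)⁻¹ *
      ∫ t in (0 : ℝ)..2 * Real.pi, ‖hardyEval p (circleMap 0 1 t)‖ ^ 2 := by
    refine (hardy_hasSum_sq p).unique ?_
    simpa [hardyEval] using hP1
  have hT : Tendsto (fun r : ℝ => (2 * Real.pi)⁻¹ *
      ∫ t in (0 : ℝ)..2 * Real.pi, ‖hardyEval h (circleMap 0 r t)‖ ^ 2) (𝓝[<] 1)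
      (𝓝 (‖p‖ ^ 2)) := by
    rw [hP2]
    refine Tendsto.const_mul _ ?_
    refine intervalIntegral.tendsto_integral_filter_of_dominated_convergence
      (fun _ => (C * B) ^ 2) ?_ ?_ (by simp) ?_
    · filter_upwards [Ioo_mem_nhdsLT (zero_lt_one (α := ℝ))] with r hr
      exact ((hardyEval_continuousOn h hr.1.le hr.2).norm.pow 2).aestronglyMeasurable
    · filter_upwards [Ioo_mem_nhdsLT (zero_lt_one (α := ℝ))] with r hr
      refine ae_of_all _ fun t _ => ?_
      have hm : circleMap 0 r t ∈ ball (0 : ℂ) 1 := by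
        simpa using circleMap_mem_disk hr.1.le hr.2 t
      rw [hh _ hm, norm_pow, norm_norm]
      have := hbd _ hm
      gcongr
    · filter_upwards [hlim] with t ht _
      obtain ⟨w, hw, hwt⟩ := ht
      have hcm : Tendsto (fun r : ℝ => hardyEval p (circleMap 0 r t)) (𝓝[<] 1)
          (𝓝 (hardyEval p (circleMap 0 1 t))) := by
        have hc : Continuous fun r : ℝ => hardyEval p (circleMap 0 r t) :=
          hpc.comp (by unfold circleMap; fun_prop)
        exact (hc.tendsto 1).mono_left nhdsWithin_le_nhds
      have h5 := ((hwt.mul hcm).norm).pow 2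
      rw [norm_mul, hw, one_mul] at h5
      refine h5.congr' ?_
      filter_upwards [Ioo_mem_nhdsLT (zero_lt_one (α := ℝ))] with r hr
      rw [hh _ (by simpa using circleMap_mem_disk hr.1.le hr.2 t)]
  exact (sq_eq_sq₀ (norm_nonneg _) (norm_nonneg _)).1
    (tendsto_nhds_unique (hardy_mean_tendsto h) hT)

theorem hardy_mul_isometry {θ : ℂ → ℂ} (hθ : IsInner θ) {h f : Hardy2}
    (hf : ∀ z ∈ ball (0 : ℂ) 1, hardyEval h z = θ z * hardyEval f z) : ‖h‖ = ‖f‖ := by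
  obtain ⟨C, hC⟩ := hθ.1.2
  have hs : Tendsto (fun s : Finset ℕ => ∑ i ∈ s, lp.single 2 i (f i)) atTop (𝓝 f) :=
    lp.hasSum_single (p := 2) (by simp) f
  have hex := fun s : Finset ℕ => hardy_mul_poly hθ (∑ i ∈ s, lp.single 2 i (f i)) s
    (fun n hn => by
      rw [lp.coeFn_sum, Finset.sum_apply]
      refine Finset.sum_eq_zero fun i hi => ?_
      exact lp.single_apply_ne 2 i _ (fun h => hn (h ▸ hi)))
  choose k hk hkn using hex
  have hkt : Tendsto k atTop (𝓝 h) := by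
    rw [tendsto_iff_norm_sub_tendsto_zero] at hs ⊢
    refine squeeze_zero (fun _ => norm_nonneg _) (fun s => ?_) (by simpa using hs.const_mul C)
    refine hardy_mul_norm_le hC fun z hz => ?_
    have hz' : ‖z‖ < 1 := by simpa using hz
    rw [hardyEval_sub _ _ hz', hardyEval_sub _ _ hz', hk s z hz, hf z hz, mul_sub]
  refine tendsto_nhds_unique hkt.norm ?_
  simpa only [hkn] using hs.norm

theorem innerRange_isClosed {θ : ℂ → ℂ} (hθ : IsInner θ) :
    IsClosed (innerRange θ : Set Hardy2) := by
  refine IsSeqClosed.isClosed fun u h hu hlim => ?_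
  choose f hf using hu
  have hc : CauchySeq f := by
    have := hlim.cauchySeq
    rw [Metric.cauchySeq_iff] at this ⊢
    intro ε hε
    obtain ⟨N, hN⟩ := this ε hε
    refine ⟨N, fun m hm n hn => ?_⟩
    have h1 := hN m hm n hn
    rw [dist_eq_norm] at h1 ⊢
    rw [← hardy_mul_isometry hθ (h := u m - u n) (f := f m - f n)]
    · exact h1
    · intro z hz
      have hz' : ‖z‖ < 1 := by simpa using hz
      rw [hardyEval_sub _ _ hz', hardyEval_sub _ _ hz', hf m z hz, hf n z hz, mul_sub]
  obtain ⟨F, hF⟩ := cauchySeq_tendsto_of_complete hc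
  refine ⟨F, fun z hz => ?_⟩
  have hz' : ‖z‖ < 1 := by simpa using hz
  refine tendsto_nhds_unique (hardyEval_tendsto hlim hz') ?_
  simpa only [hf _ z hz] using (hardyEval_tendsto hF hz').const_mul (θ z)

theorem innerRange_hasOrthogonalProjection {θ : ℂ → ℂ} (hθ : IsInner θ) :
    (innerRange θ).HasOrthogonalProjection :=
  have : CompleteSpace (innerRange θ) := (innerRange_isClosed hθ).completeSpace_coe
  inferInstance

theorem hardyShift_mem_innerRange {θ : ℂ → ℂ} {h : Hardy2} (hh : h ∈ innerRange θ) :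
    hardyShift h ∈ innerRange θ := by
  obtain ⟨f, hf⟩ := hh
  refine ⟨hardyShift f, fun z hz => ?_⟩
  have hz' : ‖z‖ < 1 := by simpa using hz
  rw [hardyEval_shift _ hz', hardyEval_shift _ hz', hf z hz]
  ring

/-- The restriction `S|_{θH²}`. -/
def shiftOnInnerRange (θ : ℂ → ℂ) : innerRange θ →L[ℂ] innerRange θ :=
  (hardyShift ∘L (innerRange θ).subtypeL).codRestrict (innerRange θ)
    fun h => hardyShift_mem_innerRange h.2

/-- The model space `𝓚_θ = H² ⊖ θH²`. -/
abbrev modelSpace (θ : ℂ → ℂ) : Submodule ℂ Hardy2 := (innerRange θ)ᗮ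

/-- The model operator `T_θ = P_{𝓚_θ} S|_{𝓚_θ}`. -/
def modelOperator (θ : ℂ → ℂ) : modelSpace θ →L[ℂ] modelSpace θ :=
  (modelSpace θ).orthogonalProjectionOnto ∘L hardyShift ∘L (modelSpace θ).subtypeL

/-- The operator `K_θ = P_{θH²} S|_{𝓚_θ}`. -/
def modelCorner {θ : ℂ → ℂ} (hθ : IsInner θ) : modelSpace θ →L[ℂ] innerRange θ :=
  haveI := innerRange_hasOrthogonalProjection hθ
  (innerRange θ).orthogonalProjectionOnto ∘L hardyShift ∘L (modelSpace θ).subtypeL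

section Operators

variable {E F : Type*} [NormedAddCommGroup E] [InnerProductSpace ℂ E]
  [NormedAddCommGroup F] [InnerProductSpace ℂ F]

/-- The block operator `(V A; 0 B)` on the Hilbert space direct sum `E ⊕ F`. -/
def upperTriangular (V : E →L[ℂ] E) (A : F →L[ℂ] E) (B : F →L[ℂ] F) :
    WithLp 2 (E × F) →L[ℂ] WithLp 2 (E × F) :=
  (WithLp.prodContinuousLinearEquiv 2 ℂ E F).symm ∘L
    ((V ∘L WithLp.fstL 2 ℂ E F + A ∘L WithLp.sndL 2 ℂ E F).prod (B ∘L WithLp.sndL 2 ℂ E F))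

theorem upperTriangular_apply (V : E →L[ℂ] E) (A : F →L[ℂ] E) (B : F →L[ℂ] F) (x : E) (y : F) :
    upperTriangular V A B (WithLp.toLp 2 (x, y)) = WithLp.toLp 2 (V x + A y, B y) := rfl

/-- A quasiaffinity: trivial kernel and dense range. -/
def IsQuasiaffinity (X : E →L[ℂ] F) : Prop :=
  LinearMap.ker (X : E →ₗ[ℂ] F) = ⊥ ∧ DenseRange X

/-- `T ≺ R`: a quasiaffinity intertwines `T` and `R`. -/
def QuasiaffineTransform (T : E →L[ℂ] E) (R : F →L[ℂ] F) : Prop :=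
  ∃ X : E →L[ℂ] F, IsQuasiaffinity X ∧ X ∘L T = R ∘L X

/-- `T ∼ R`: quasisimilarity. -/
def Quasisimilar (T : E →L[ℂ] E) (R : F →L[ℂ] F) : Prop :=
  QuasiaffineTransform T R ∧ QuasiaffineTransform R T

/-- `A = φ(T)` in the `H^∞` functional calculus of a contraction `T`: with `φ(z) = ∑ cₙ zⁿ`, the
operators `∑ cₙ rⁿ Tⁿ` converge strongly to `A` as `r → 1-`. -/
def IsHInftyCalculus (φ : ℂ → ℂ) (T A : E →L[ℂ] E) : Prop :=
  ∀ x : E, Tendsto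
    (fun r : ℝ => ∑' n : ℕ, ((n.factorial : ℂ)⁻¹ * iteratedDeriv n φ 0 * (r : ℂ) ^ n) • (T ^ n) x)
    (𝓝[<] 1) (𝓝 (A x))

end Operators

/-- The operator `T = (S|_{θH²} A; 0 T₀)` on `θH² ⊕ 𝓗`, where
`A = S|_{θH²} Z - Z T₀ + K_θ Y₀`. -/
def modelExtension {θ : ℂ → ℂ} (hθ : IsInner θ) {H : Type*} [NormedAddCommGroup H]
    [InnerProductSpace ℂ H] (T₀ : H →L[ℂ] H) (Y₀ : H →L[ℂ] modelSpace θ)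
    (Z : H →L[ℂ] innerRange θ) :
    WithLp 2 (innerRange θ × H) →L[ℂ] WithLp 2 (innerRange θ × H) :=
  upperTriangular (shiftOnInnerRange θ)
    (shiftOnInnerRange θ ∘L Z - Z ∘L T₀ + modelCorner hθ ∘L Y₀) T₀

end

open Filter Topology MeasureTheory Metric

/-! Write `Y` for the block operator `(I Z; 0 Y₀)` from `θH² ⊕ 𝓗` to `θH² ⊕ 𝓚_θ = H²`. The formula
for `A` says exactly that `Y T = S Y`, and `Y` is a quasiaffinity because `Y₀` is. Hence `T ≺ S`
always holds, and the theorem concerns `S ≺ T`.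

If `X` is a quasiaffinity with `X S = T X`, then `Y X` commutes with `S`, so it is multiplication by
some `g ∈ H^∞`, with dense range. As `Y X` preserves `θH²` and `Y₀` is injective, the second
component of `X` vanishes on `θH²`; its restriction `X₀` to `𝓚_θ` satisfies `Y₀ X₀ = g(T_θ)`.
Injectivity of `X₀` is the coprimality of outer and inner functions: `g k ∈ θH²` forces `k ∈ θH²`.
Conversely, given `X₀` and `g`, the equation `Y X = g(S)` can be solved for `X`, and `X` inherits
its properties from `g`, `X₀` and `Y`.

The analytic input is that a bounded `g` is outer, in the sense of the integral formula, exactly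
when `g H²` is dense. If `g` is outer, truncating the boundary function of `1 / g` gives bounded `h
n` with `h n * g` converging strongly to a nonzero constant (`IsOuter.exists_hardyMul_tendsto`). If
`g H²` is dense, choose `q` with `g q` close to `1`; Jensen's inequality makes `log |g q|` small in
the mean on every circle, so `log |g (rζ)|` is Cauchy in `L¹` as `r → 1`, and its limit represents
`g` (`isOuter_of_denseRange`). -/

/-! ### Point values, Taylor coefficients and cyclicity of constants in `H²`. -/

theorem hardyEval_ext {f g : Hardy2} (h : ∀ z ∈ ball (0 : ℂ) 1, hardyEval f z = hardyEval g z) :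
    f = g := by
  -- The difference is a multiple by the zero function, so the multiplier bound with constant `0`
  -- kills it.
  have := hardy_mul_norm_le (θ := fun _ => 0) (C := 0) (by simp) (h := f - g) (f := 0)
    fun z hz => by
      rw [hardyEval_sub _ _ (by simpa using hz), h z hz]; simp
  exact sub_eq_zero.1 (norm_le_zero_iff.1 (by simpa using this))

theorem hardyEval_single (n : ℕ) (c z : ℂ) : hardyEval (lp.single 2 n c) z = c * z ^ n := by
  rw [hardyEval, tsum_eq_single n]
  · simp
  · intro m hm
    rw [lp.single_apply_ne _ _ _ hm, zero_mul]

theorem hardyEval_zero (f : Hardy2) : hardyEval f 0 = f 0 := by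
  rw [hardyEval, tsum_eq_single 0]
  · simp
  · intro n hn
    simp [hn]

theorem hardyEval_differentiableOn (f : Hardy2) :
    DifferentiableOn ℂ (hardyEval f) (ball 0 1) := by
  intro z hz
  obtain ⟨r, hzr, hr⟩ := exists_between (show ‖z‖ < 1 by simpa using hz)
  have h0 : 0 ≤ r := (norm_nonneg z).trans hzr.le
  have : DifferentiableOn ℂ (fun w => ∑' n, f n * w ^ n) (ball 0 r) :=
    Complex.differentiableOn_tsum_of_summable_norm (hardy_summable_norm f h0 hr)
      (fun n => by fun_prop) isOpen_ball fun n w hw => by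
        have : ‖w‖ ≤ r := by simpa using (mem_ball.1 hw).le
        rw [norm_mul, norm_pow]
        gcongr
  exact ((this z (by simpa using hzr)).differentiableAt
    (isOpen_ball.mem_nhds (by simpa using hzr))).differentiableWithinAt

theorem hardyEval_hasFPowerSeriesAt (f : Hardy2) :
    HasFPowerSeriesAt (hardyEval f) (FormalMultilinearSeries.ofScalars ℂ (fun n => f n)) 0 := by
  rw [hasFPowerSeriesAt_iff]
  filter_upwards [ball_mem_nhds (0 : ℂ) one_pos] with z hz
  rw [zero_add]
  have := (hardy_summable f (by simpa using hz)).hasSum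
  simpa [hardyEval, FormalMultilinearSeries.coeff_ofScalars, mul_comm] using this

/-- The Taylor coefficients at the origin of the analytic function `f`. -/
theorem hardy_taylorCoeff {f : Hardy2} {φ : ℂ → ℂ}
    (h : ∀ z ∈ ball (0 : ℂ) 1, hardyEval f z = φ z) (n : ℕ) :
    (n.factorial : ℂ)⁻¹ * iteratedDeriv n φ 0 = f n := by
  have he : hardyEval f =ᶠ[𝓝 0] φ := by
    filter_upwards [ball_mem_nhds (0 : ℂ) one_pos] with z hz using h z hz
  rw [← he.iteratedDeriv_eq]
  have h1 := (hardyEval_hasFPowerSeriesAt f)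
  have h2 := h1.analyticAt.hasFPowerSeriesAt
  have := congrArg (fun p => FormalMultilinearSeries.coeff p n)
    (h1.eq_formalMultilinearSeries h2)
  simp only [FormalMultilinearSeries.coeff_ofScalars] at this
  rw [this, div_eq_inv_mul]

/-- A closed subspace that contains all monomials is everything. -/
theorem hardy_submodule_eq_top {M : Submodule ℂ Hardy2} (hM : IsClosed (M : Set Hardy2))
    (h : ∀ n, lp.single 2 n (1 : ℂ) ∈ M) : M = ⊤ := by
  refine eq_top_iff.2 fun f _ => ?_
  have hs : HasSum (fun i => lp.single 2 i (f i)) f := lp.hasSum_single (p := 2) (by simp) f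
  refine hM.mem_of_tendsto hs (Eventually.of_forall fun s => M.sum_mem fun i _ => ?_)
  have := M.smul_mem (f i) (h i)
  rwa [← lp.single_smul, smul_eq_mul, mul_one] at this

theorem hardyShift_single (n : ℕ) (c : ℂ) :
    hardyShift (lp.single 2 n c) = lp.single 2 (n + 1) c := by
  refine hardyEval_ext fun z hz => ?_
  rw [hardyEval_shift _ (by simpa using hz), hardyEval_single, hardyEval_single]
  ring

/-- A closed shift-invariant subspace that contains a nonzero constant is everything. -/
theorem hardy_invariant_eq_top {M : Submodule ℂ Hardy2} (hM : IsClosed (M : Set Hardy2))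
    (hS : ∀ f ∈ M, hardyShift f ∈ M) (h : lp.single 2 0 (1 : ℂ) ∈ M) : M = ⊤ := by
  refine hardy_submodule_eq_top hM fun n => ?_
  induction n with
  | zero => exact h
  | succ n ih => rw [← hardyShift_single]; exact hS _ ih

/-! ### Multipliers and the commutant of the shift. -/

theorem IsHInfty.mul {φ ψ : ℂ → ℂ} (hφ : IsHInfty φ) (hψ : IsHInfty ψ) :
    IsHInfty (fun z => φ z * ψ z) := by
  obtain ⟨h1, C, hC⟩ := hφ
  obtain ⟨h2, D, hD⟩ := hψ
  refine ⟨h1.mul h2, C * D, fun z hz => ?_⟩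
  rw [norm_mul]
  exact mul_le_mul (hC z hz) (hD z hz) (norm_nonneg _) ((norm_nonneg _).trans (hC z hz))

/-- The admissible `f` form a subspace, closed because the bound on `φ` makes the products Cauchy.
It contains the monomials, since `φ z ^ n` is bounded and analytic. -/
theorem IsHInfty.exists_mul {φ : ℂ → ℂ} (hφ : IsHInfty φ) (f : Hardy2) :
    ∃ h : Hardy2, ∀ z ∈ ball (0 : ℂ) 1, hardyEval h z = φ z * hardyEval f z := by
  obtain ⟨C, hC⟩ := hφ.2
  let M : Submodule ℂ Hardy2 :=
    { carrier := {f | ∃ h : Hardy2, ∀ z ∈ ball (0 : ℂ) 1, hardyEval h z = φ z * hardyEval f z}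
      add_mem' := by
        rintro f g ⟨h, hh⟩ ⟨k, hk⟩
        refine ⟨h + k, fun z hz => ?_⟩
        have hz' : ‖z‖ < 1 := by simpa using hz
        rw [hardyEval_add _ _ hz', hardyEval_add _ _ hz', hh z hz, hk z hz, mul_add]
      zero_mem' := ⟨0, fun z _ => by simp [hardyEval]⟩
      smul_mem' := by
        rintro c f ⟨h, hh⟩
        refine ⟨c • h, fun z hz => ?_⟩
        rw [hardyEval_smul, hardyEval_smul, hh z hz]
        ring }
  have hM : IsClosed (M : Set Hardy2) := by
    refine IsSeqClosed.isClosed fun u f hu hlim => ?_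
    choose h hh using hu
    have hc : CauchySeq h := by
      have h1 : CauchySeq fun n => C • u n := (hlim.const_smul C).cauchySeq
      rw [Metric.cauchySeq_iff] at h1 ⊢
      intro ε hε
      obtain ⟨N, hN⟩ := h1 ε hε
      refine ⟨N, fun m hm n hn => lt_of_le_of_lt ?_ (hN m hm n hn)⟩
      have hC0 : 0 ≤ C := (norm_nonneg _).trans (hC 0 (by simp))
      rw [dist_eq_norm, dist_eq_norm, ← smul_sub, norm_smul, Real.norm_of_nonneg hC0]
      refine hardy_mul_norm_le hC fun z hz => ?_
      have hz' : ‖z‖ < 1 := by simpa using hz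
      rw [hardyEval_sub _ _ hz', hardyEval_sub _ _ hz', hh m z hz, hh n z hz, mul_sub]
    obtain ⟨F, hF⟩ := cauchySeq_tendsto_of_complete hc
    refine ⟨F, fun z hz => ?_⟩
    have hz' : ‖z‖ < 1 := by simpa using hz
    refine tendsto_nhds_unique (hardyEval_tendsto hF hz') ?_
    simpa only [hh _ z hz] using (hardyEval_tendsto hlim hz').const_mul (φ z)
  have : M = ⊤ := by
    refine hardy_submodule_eq_top hM fun n => ?_
    have hp : IsHInfty (fun z : ℂ => z ^ n) := ⟨by fun_prop, 1, fun z hz => by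
      rw [norm_pow]; exact pow_le_one₀ (norm_nonneg _) (by simpa using (mem_ball.1 hz).le)⟩
    obtain ⟨h, hh⟩ := hardy_of_isHInfty (hφ.mul hp)
    exact ⟨h, fun z hz => by rw [hh z hz, hardyEval_single, one_mul]⟩
  exact (this ▸ Submodule.mem_top : f ∈ M)

/-- Multiplication by `φ ∈ H^∞` on `H²`. -/
noncomputable def hardyMul {φ : ℂ → ℂ} (hφ : IsHInfty φ) : Hardy2 →L[ℂ] Hardy2 :=
  LinearMap.mkContinuous
    { toFun := fun f => (hφ.exists_mul f).choose
      map_add' := fun f g => hardyEval_ext fun z hz => by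
        have hz' : ‖z‖ < 1 := by simpa using hz
        rw [hardyEval_add _ _ hz', (hφ.exists_mul _).choose_spec z hz,
          (hφ.exists_mul _).choose_spec z hz, (hφ.exists_mul _).choose_spec z hz,
          hardyEval_add _ _ hz', mul_add]
      map_smul' := fun c f => hardyEval_ext fun z hz => by
        rw [RingHom.id_apply, hardyEval_smul, (hφ.exists_mul _).choose_spec z hz,
          (hφ.exists_mul _).choose_spec z hz, hardyEval_smul]
        ring }
    hφ.2.choose fun f => hardy_mul_norm_le hφ.2.choose_spec (hφ.exists_mul f).choose_spec

theorem hardyEval_mul {φ : ℂ → ℂ} (hφ : IsHInfty φ) (f : Hardy2) {z : ℂ}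
    (hz : z ∈ ball (0 : ℂ) 1) : hardyEval (hardyMul hφ f) z = φ z * hardyEval f z :=
  (hφ.exists_mul f).choose_spec z hz

theorem hardyMul_eq {φ : ℂ → ℂ} (hφ : IsHInfty φ) {f h : Hardy2}
    (hh : ∀ z ∈ ball (0 : ℂ) 1, hardyEval h z = φ z * hardyEval f z) : hardyMul hφ f = h :=
  hardyEval_ext fun z hz => by rw [hardyEval_mul hφ f hz, hh z hz]

theorem norm_hardyMul_le {φ : ℂ → ℂ} (hφ : IsHInfty φ) {C : ℝ}
    (hC : ∀ z ∈ ball (0 : ℂ) 1, ‖φ z‖ ≤ C) (f : Hardy2) : ‖hardyMul hφ f‖ ≤ C * ‖f‖ :=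
  hardy_mul_norm_le hC fun _ hz => hardyEval_mul hφ f hz

theorem hardyMul_shift {φ : ℂ → ℂ} (hφ : IsHInfty φ) (f : Hardy2) :
    hardyMul hφ (hardyShift f) = hardyShift (hardyMul hφ f) :=
  hardyMul_eq hφ fun z hz => by
    have hz' : ‖z‖ < 1 := by simpa using hz
    rw [hardyEval_shift _ hz', hardyEval_shift _ hz', hardyEval_mul hφ f hz]
    ring

theorem hardyMul_comm {φ ψ : ℂ → ℂ} (hφ : IsHInfty φ) (hψ : IsHInfty ψ) (f : Hardy2) :
    hardyMul hφ (hardyMul hψ f) = hardyMul hψ (hardyMul hφ f) :=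
  hardyMul_eq hφ fun z hz => by
    rw [hardyEval_mul _ _ hz, hardyEval_mul _ _ hz, hardyEval_mul _ _ hz]
    ring

theorem hardyMul_mem_innerRange {φ θ : ℂ → ℂ} (hφ : IsHInfty φ) {h : Hardy2}
    (hh : h ∈ innerRange θ) : hardyMul hφ h ∈ innerRange θ := by
  obtain ⟨f, hf⟩ := hh
  refine ⟨hardyMul hφ f, fun z hz => ?_⟩
  rw [hardyEval_mul _ _ hz, hardyEval_mul _ _ hz, hf z hz]
  ring

/-- The operators that commute with the shift are the multiplications by functions in `H^∞`. -/
theorem exists_eq_hardyMul {B : Hardy2 →L[ℂ] Hardy2}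
    (hB : ∀ f, B (hardyShift f) = hardyShift (B f)) :
    ∃ (g : ℂ → ℂ) (hg : IsHInfty g), B = hardyMul hg := by
  -- The symbol must be the image of the constant `1`; the vectors on which `B` multiplies by it
  -- form a closed invariant subspace.
  set g : ℂ → ℂ := hardyEval (B (lp.single 2 0 1)) with hgdef
  have hmul : ∀ f, ∀ z ∈ ball (0 : ℂ) 1, hardyEval (B f) z = g z * hardyEval f z := by
    let M : Submodule ℂ Hardy2 :=
      { carrier := {f | ∀ z ∈ ball (0 : ℂ) 1, hardyEval (B f) z = g z * hardyEval f z}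
        add_mem' := by
          intro f h hf hh z hz
          have hz' : ‖z‖ < 1 := by simpa using hz
          rw [map_add, hardyEval_add _ _ hz', hardyEval_add _ _ hz', hf z hz, hh z hz, mul_add]
        zero_mem' := fun z _ => by simp [hardyEval]
        smul_mem' := by
          intro c f hf z hz
          rw [map_smul, hardyEval_smul, hardyEval_smul, hf z hz]
          ring }
    have hM : IsClosed (M : Set Hardy2) := by
      refine IsSeqClosed.isClosed fun u f hu hlim z hz => ?_
      have hz' : ‖z‖ < 1 := by simpa using hz
      refine tendsto_nhds_unique
        (hardyEval_tendsto ((B.continuous.tendsto f).comp hlim) hz') ?_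
      simpa only [Function.comp_def, hu _ z hz] using
        (hardyEval_tendsto hlim hz').const_mul (g z)
    have : M = ⊤ := by
      refine hardy_invariant_eq_top hM (fun f hf z hz => ?_) fun z hz => ?_
      · have hz' : ‖z‖ < 1 := by simpa using hz
        rw [hB, hardyEval_shift _ hz', hardyEval_shift _ hz', hf z hz]
        ring
      · rw [hardyEval_single]; simp [hgdef]
    exact fun f => (this ▸ Submodule.mem_top : f ∈ M)
  -- Boundedness of `g`: as `B ^ n` sends `1` to `g ^ n`, point evaluation gives `|g z| ^ n ≤ (1 -
  -- |z|)⁻¹ ‖B‖ ^ n` for all `n`, which is impossible if `|g z| > ‖B‖`.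
  have hpow : ∀ n : ℕ, ∀ z ∈ ball (0 : ℂ) 1,
      hardyEval ((B ^ n) (lp.single 2 0 1)) z = g z ^ n := by
    intro n z hz
    induction n with
    | zero => simp [hardyEval_single]
    | succ n ih => rw [pow_succ', mul_apply_eq_comp, hmul _ z hz, ih, pow_succ']
  have hg : IsHInfty g := by
    refine ⟨hardyEval_differentiableOn _, ‖B‖, fun z hz => ?_⟩
    by_contra! hlt
    have hz' : ‖z‖ < 1 := by simpa using hz
    have hb : ∀ n : ℕ, ‖g z‖ ^ n ≤ (1 - ‖z‖)⁻¹ * ‖B‖ ^ n := by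
      intro n
      rw [← norm_pow, ← hpow n z hz]
      refine (hardyEval_norm_le _ hz').trans ?_
      rw [mul_comm]
      have : 0 ≤ (1 - ‖z‖)⁻¹ := inv_nonneg.2 (by linarith)
      refine mul_le_mul_of_nonneg_left ?_ this
      induction n with
      | zero => simp [lp.norm_single]
      | succ n ih =>
        rw [pow_succ', mul_apply_eq_comp, pow_succ']
        exact (B.le_opNorm _).trans (mul_le_mul_of_nonneg_left ih (norm_nonneg _))
    by_cases h0 : ‖B‖ = 0
    · have := hb 1
      rw [h0] at this hlt
      simp at this
      simp [this] at hlt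
    · have hBpos : 0 < ‖B‖ := lt_of_le_of_ne (norm_nonneg _) (Ne.symm h0)
      obtain ⟨n, hn⟩ := pow_unbounded_of_one_lt (1 - ‖z‖)⁻¹ ((one_lt_div hBpos).2 hlt)
      rw [div_pow, lt_div_iff₀ (by positivity)] at hn
      exact absurd (hb n) (not_le.2 hn)
  exact ⟨g, hg, ContinuousLinearMap.ext fun f => (hardyMul_eq hg (hmul f)).symm⟩

/-! ### Dilations and the functional calculus of the shift. -/

open Classical in
/-- The dilation `z ↦ f (rz)` of `f ∈ H²`, for `0 ≤ r ≤ 1`. -/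
noncomputable def hardyDilate (r : ℝ) (f : Hardy2) : Hardy2 :=
  if h : Memℓp (E := fun _ : ℕ => ℂ) (fun n => f n * (r : ℂ) ^ n) 2 then ⟨_, h⟩ else 0

theorem hardyDilate_apply {r : ℝ} (h0 : 0 ≤ r) (h1 : r ≤ 1) (f : Hardy2) (n : ℕ) :
    hardyDilate r f n = f n * (r : ℂ) ^ n := by
  rw [hardyDilate, dif_pos]
  refine hardy_memlp (Summable.of_nonneg_of_le (fun n => by positivity) (fun n => ?_)
    (hardy_hasSum_sq f).summable)
  rw [norm_mul, norm_pow, Complex.norm_real, Real.norm_of_nonneg h0]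
  have : ‖f n‖ * r ^ n ≤ ‖f n‖ :=
    mul_le_of_le_one_right (norm_nonneg _) (pow_le_one₀ h0 h1)
  gcongr

theorem hardyEval_dilate {r : ℝ} (h0 : 0 ≤ r) (h1 : r ≤ 1) (f : Hardy2) (z : ℂ) :
    hardyEval (hardyDilate r f) z = hardyEval f (r * z) :=
  tsum_congr fun n => by rw [hardyDilate_apply h0 h1, mul_pow, mul_assoc]

/-- Dominated convergence for the squared coefficients, with majorant `‖f n‖ ^ 2`. -/
theorem hardyDilate_tendsto (f : Hardy2) :
    Tendsto (fun r : ℝ => hardyDilate r f) (𝓝[<] 1) (𝓝 f) := by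
  rw [tendsto_iff_norm_sub_tendsto_zero]
  have hs : Tendsto (fun r : ℝ => ‖hardyDilate r f - f‖ ^ 2) (𝓝[<] 1) (𝓝 0) := by
    have h1 : Tendsto (fun r : ℝ => ∑' n, ‖f n * (r : ℂ) ^ n - f n‖ ^ 2) (𝓝[<] 1)
        (𝓝 (∑' _ : ℕ, (0 : ℝ))) := by
      refine tendsto_tsum_of_dominated_convergence (hardy_hasSum_sq f).summable (fun n => ?_) ?_
      · have hc : Continuous fun r : ℝ => ‖f n * (r : ℂ) ^ n - f n‖ ^ 2 := by fun_prop
        simpa using (hc.tendsto 1).mono_left nhdsWithin_le_nhds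
      · filter_upwards [Ioo_mem_nhdsLT (zero_lt_one (α := ℝ))] with r hr n
        have h2 : f n * (r : ℂ) ^ n - f n = f n * ((r ^ n - 1 : ℝ) : ℂ) := by
          push_cast; ring
        have h3 : |r ^ n - 1| ≤ 1 := by
          have := pow_le_one₀ (n := n) hr.1.le hr.2.le
          have := pow_nonneg hr.1.le n
          rw [abs_le]; constructor <;> linarith
        rw [norm_pow, norm_norm, h2, norm_mul, Complex.norm_real, Real.norm_eq_abs]
        have := mul_le_of_le_one_right (norm_nonneg (f n)) h3
        gcongr
    rw [tsum_zero] at h1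
    refine h1.congr' ?_
    filter_upwards [Ioo_mem_nhdsLT (zero_lt_one (α := ℝ))] with r hr
    rw [← (hardy_hasSum_sq _).tsum_eq]
    refine tsum_congr fun n => ?_
    rw [lp.coeFn_sub, Pi.sub_apply, hardyDilate_apply hr.1.le hr.2.le]
  simpa [Real.sqrt_sq (norm_nonneg _)] using hs.sqrt

theorem hardyShift_pow_eval (n : ℕ) (f : Hardy2) {z : ℂ} (hz : ‖z‖ < 1) :
    hardyEval ((hardyShift ^ n) f) z = z ^ n * hardyEval f z := by
  induction n with
  | zero => simp
  | succ n ih =>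
    rw [pow_succ', mul_apply_eq_comp, hardyEval_shift _ hz, ih]
    ring

theorem norm_hardyShift_pow (n : ℕ) (f : Hardy2) : ‖(hardyShift ^ n) f‖ = ‖f‖ := by
  induction n with
  | zero => simp
  | succ n ih =>
    rw [pow_succ', mul_apply_eq_comp]
    exact (hardyShiftLinear_norm _).trans ih

/-- Evaluation at a point of the disk as a functional. -/
noncomputable def hardyEvalCLM {z : ℂ} (hz : ‖z‖ < 1) : Hardy2 →L[ℂ] ℂ :=
  LinearMap.mkContinuous
    { toFun := fun f => hardyEval f z
      map_add' := fun f g => hardyEval_add f g hz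
      map_smul' := fun c f => hardyEval_smul c f z } (1 - ‖z‖)⁻¹
    fun f => (hardyEval_norm_le f hz).trans_eq (mul_comm _ _)

theorem hardy_calculus_summable (a : Hardy2) (f : Hardy2) {r : ℝ} (h0 : 0 ≤ r) (h1 : r < 1) :
    Summable fun n => (a n * (r : ℂ) ^ n) • (hardyShift ^ n) f := by
  refine Summable.of_norm ?_
  have := (hardy_summable_norm a h0 h1).mul_right ‖f‖
  refine this.congr fun n => ?_
  rw [norm_smul, norm_hardyShift_pow, norm_mul, norm_pow, Complex.norm_real,
    Real.norm_of_nonneg h0]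

theorem hardy_calculus_eval (a f : Hardy2) {r : ℝ} (h0 : 0 ≤ r) (h1 : r < 1) {z : ℂ}
    (hz : ‖z‖ < 1) : hardyEval (∑' n, (a n * (r : ℂ) ^ n) • (hardyShift ^ n) f) z =
      hardyEval a (r * z) * hardyEval f z := by
  have := (hardyEvalCLM hz).map_tsum (hardy_calculus_summable a f h0 h1)
  refine this.trans ?_
  rw [hardyEval, ← tsum_mul_right]
  refine tsum_congr fun n => ?_
  rw [map_smul]
  change _ * hardyEval _ z = _
  rw [hardyShift_pow_eval n f hz]
  ring

/-- The functional calculus of the shift: `g(S)` is multiplication by `g`. -/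
theorem hardy_calculus_tendsto {g : ℂ → ℂ} (hg : IsHInfty g) (f : Hardy2) :
    Tendsto (fun r : ℝ => ∑' n : ℕ,
      ((n.factorial : ℂ)⁻¹ * iteratedDeriv n g 0 * (r : ℂ) ^ n) • (hardyShift ^ n) f)
      (𝓝[<] 1) (𝓝 (hardyMul hg f)) := by
  obtain ⟨a, ha⟩ := hardy_of_isHInfty hg
  obtain ⟨C, hC⟩ := hg.2
  simp only [hardy_taylorCoeff ha]
  have h1 : Tendsto (fun r : ℝ => C * ‖hardyDilate r f - f‖ +
      ‖hardyDilate r (hardyMul hg f) - hardyMul hg f‖) (𝓝[<] 1) (𝓝 0) := by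
    have h2 := tendsto_iff_norm_sub_tendsto_zero.1 (hardyDilate_tendsto f)
    have h3 := tendsto_iff_norm_sub_tendsto_zero.1 (hardyDilate_tendsto (hardyMul hg f))
    simpa using (h2.const_mul C).add h3
  rw [tendsto_iff_norm_sub_tendsto_zero]
  refine squeeze_zero' (Eventually.of_forall fun _ => norm_nonneg _) ?_ h1
  filter_upwards [Ioo_mem_nhdsLT (zero_lt_one (α := ℝ))] with r hr
  have hrz : ∀ z ∈ ball (0 : ℂ) 1, (r : ℂ) * z ∈ ball (0 : ℂ) 1 := by
    intro z hz
    have hz' : ‖z‖ < 1 := by simpa using hz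
    rw [mem_ball_zero_iff, norm_mul, Complex.norm_real, Real.norm_of_nonneg hr.1.le]
    nlinarith [hr.1, hr.2, norm_nonneg z]
  set h := ∑' n, (a n * (r : ℂ) ^ n) • (hardyShift ^ n) f with hh
  -- The Abel sum `h` is `g (rz) f(z)`, while the dilation of `g f` is `g (rz) f (rz)`. The
  -- difference has the factor `f - f_r`, so only the bound `C` on `g` is needed.
  have h4 : ‖h - hardyDilate r (hardyMul hg f)‖ ≤ C * ‖f - hardyDilate r f‖ := by
    refine hardy_mul_norm_le (θ := fun z => g (r * z)) (fun z hz => hC _ (hrz z hz))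
      fun z hz => ?_
    have hz' : ‖z‖ < 1 := by simpa using hz
    rw [hardyEval_sub _ _ hz', hardyEval_sub _ _ hz', hh, hardy_calculus_eval a f hr.1.le hr.2 hz',
      hardyEval_dilate hr.1.le hr.2.le, hardyEval_dilate hr.1.le hr.2.le,
      hardyEval_mul hg _ (hrz z hz), ha _ (hrz z hz)]
    ring
  rw [norm_sub_rev f] at h4
  calc ‖h - hardyMul hg f‖ = ‖(h - hardyDilate r (hardyMul hg f)) +
        (hardyDilate r (hardyMul hg f) - hardyMul hg f)‖ := by rw [sub_add_sub_cancel]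
    _ ≤ _ := (norm_add_le _ _).trans (add_le_add_left h4 _)

/-! ### Herglotz integrals. -/

/-- The Herglotz integral of a function on the unit circle. -/
noncomputable def herglotzIntegral (u : ℂ → ℝ) (z : ℂ) : ℂ :=
  Real.circleAverage (fun ζ => (ζ + z) / (ζ - z) * (u ζ : ℂ)) 0 1

theorem herglotz_continuousOn {z : ℂ} (hz : z ∈ ball (0 : ℂ) 1) :
    ContinuousOn (fun ζ : ℂ => (ζ + z) / (ζ - z)) (sphere 0 |1|) := by
  refine ContinuousOn.div (by fun_prop) (by fun_prop) fun ζ hζ h => ?_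
  rw [sub_eq_zero.1 h] at hζ
  simp at hζ hz
  linarith

theorem CircleIntegrable.ofReal {u : ℂ → ℝ} {c : ℂ} {R : ℝ} (hu : CircleIntegrable u c R) :
    CircleIntegrable (fun ζ => (u ζ : ℂ)) c R := by
  simp only [CircleIntegrable, intervalIntegrable_iff] at hu ⊢
  exact Complex.ofRealCLM.integrable_comp hu

theorem herglotz_integrable {u : ℂ → ℝ} (hu : CircleIntegrable u 0 1) {z : ℂ}
    (hz : z ∈ ball (0 : ℂ) 1) :
    CircleIntegrable (fun ζ => (ζ + z) / (ζ - z) * (u ζ : ℂ)) 0 1 :=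
  hu.ofReal.continuousOn_smul (herglotz_continuousOn hz)

theorem herglotzIntegral_add {u v : ℂ → ℝ} (hu : CircleIntegrable u 0 1)
    (hv : CircleIntegrable v 0 1) {z : ℂ} (hz : z ∈ ball (0 : ℂ) 1) :
    herglotzIntegral (fun ζ => u ζ + v ζ) z = herglotzIntegral u z + herglotzIntegral v z := by
  rw [herglotzIntegral, herglotzIntegral, herglotzIntegral,
    ← Real.circleAverage_fun_add (herglotz_integrable hu hz) (herglotz_integrable hv hz)]
  simp [mul_add]

theorem herglotzIntegral_differentiableOn {u : ℂ → ℝ} (hu : CircleIntegrable u 0 1) :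
    DifferentiableOn ℂ (herglotzIntegral u) (ball 0 1) := by
  have := differentiableOn_circleAverage_herglotzRieszKernel_smul hu.ofReal
  simp only [herglotzRieszKernel_def, sub_zero, smul_eq_mul] at this
  exact this

theorem herglotzIntegral_zero (u : ℂ → ℝ) :
    herglotzIntegral u 0 = (Real.circleAverage u 0 1 : ℝ) := by
  rw [herglotzIntegral, Real.circleAverage_def, Real.circleAverage_def]
  simp only [add_zero, sub_zero, smul_eq_mul, Complex.ofReal_mul]
  rw [← intervalIntegral.integral_ofReal, Complex.real_smul]
  congr 1
  refine intervalIntegral.integral_congr fun t _ => ?_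
  simp

theorem re_herglotzRieszKernel_smul (u : ℂ → ℝ) (z : ℂ) :
    (Complex.re ∘ herglotzRieszKernel 0 z) • u = fun ζ => ((ζ + z) / (ζ - z)).re * u ζ := by
  funext ζ
  simp [herglotzRieszKernel_def]

theorem herglotzIntegral_re {u : ℂ → ℝ} (hu : CircleIntegrable u 0 1) {z : ℂ}
    (hz : z ∈ ball (0 : ℂ) 1) : (herglotzIntegral u z).re =
      Real.circleAverage (fun ζ => ((ζ + z) / (ζ - z)).re * u ζ) 0 1 := by
  have := re_circleAverage_herglotzRieszKernel_smul hu hz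
  rw [re_herglotzRieszKernel_smul] at this
  simp only [herglotzRieszKernel_def, sub_zero, smul_eq_mul] at this
  exact this

theorem herglotz_re_nonneg {z ζ : ℂ} (hz : z ∈ ball (0 : ℂ) 1) (hζ : ζ ∈ sphere (0 : ℂ) 1) :
    0 ≤ ((ζ + z) / (ζ - z)).re := by
  have := le_re_herglotzRieszKernel hζ hz
  simp only [sub_zero] at this
  refine le_trans ?_ this
  have : ‖z‖ < 1 := by simpa using hz
  exact div_nonneg (by linarith) (by positivity)

/-- Poisson's formula for the harmonic function `1`. -/
theorem circleAverage_herglotz_re {z : ℂ} (hz : z ∈ ball (0 : ℂ) 1) :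
    Real.circleAverage (fun ζ => ((ζ + z) / (ζ - z)).re) 0 1 = 1 := by
  have := InnerProductSpace.HarmonicOnNhd.circleAverage_re_herglotzRieszKernel_smul
    (f := fun _ => (1 : ℝ)) (c := 0) (R := 1) (w := z)
    (fun _ _ => InnerProductSpace.harmonicAt_const 1) hz
  rw [re_herglotzRieszKernel_smul] at this
  simpa only [mul_one] using this

/-- The real part is an average of `u` against the Poisson kernel, which is nonnegative of mass `1`.
-/
theorem herglotzIntegral_re_le {u : ℂ → ℝ} (hu : CircleIntegrable u 0 1) {M : ℝ}
    (hM : ∀ ζ, u ζ ≤ M) {z : ℂ} (hz : z ∈ ball (0 : ℂ) 1) :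
    (herglotzIntegral u z).re ≤ M := by
  have hk : ContinuousOn (fun ζ : ℂ => ((ζ + z) / (ζ - z)).re) (sphere 0 |1|) :=
    Complex.continuous_re.comp_continuousOn (herglotz_continuousOn hz)
  have h1 : Real.circleAverage (fun ζ => ((ζ + z) / (ζ - z)).re * M) 0 1 = M := by
    have := Real.circleAverage_fun_smul (a := M) (c := 0) (R := 1)
      (f := fun ζ => ((ζ + z) / (ζ - z)).re)
    simp only [smul_eq_mul, circleAverage_herglotz_re hz, mul_one] at this
    simpa only [mul_comm] using this
  rw [herglotzIntegral_re hu hz]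
  refine (Real.circleAverage_mono (hu.continuousOn_smul hk)
    (ContinuousOn.circleIntegrable' (hk.mul continuousOn_const)) fun ζ hζ => ?_).trans h1.le
  exact mul_le_mul_of_nonneg_left (hM ζ) (herglotz_re_nonneg hz (by simpa using hζ))

theorem isHInfty_exp_herglotzIntegral {u : ℂ → ℝ} (hu : CircleIntegrable u 0 1) {M : ℝ}
    (hM : ∀ ζ, u ζ ≤ M) : IsHInfty fun z => Complex.exp (herglotzIntegral u z) := by
  refine ⟨(herglotzIntegral_differentiableOn hu).cexp, Real.exp M, fun z hz => ?_⟩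
  rw [Complex.norm_exp, Real.exp_le_exp]
  exact herglotzIntegral_re_le hu hM hz

/-! ### Outer functions are cyclic and coprime to inner functions. -/

/-- Expand the square: both vectors have norm at most `1`, and the inner product with a constant
sees only the value `φ 0`. -/
theorem norm_hardyMul_sub_const_le {φ : ℂ → ℂ} (hφ : IsHInfty φ)
    (h1 : ∀ z ∈ ball (0 : ℂ) 1, ‖φ z‖ ≤ 1) {c : ℂ} (hc : ‖c‖ = 1) :
    ‖hardyMul hφ (lp.single 2 0 1) - lp.single 2 0 c‖ ^ 2 ≤ 2 * ‖φ 0 - c‖ := by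
  set F := hardyMul hφ (lp.single 2 0 1) with hF
  have hF1 : ‖F‖ ≤ 1 := by
    have := norm_hardyMul_le hφ h1 (lp.single 2 0 1)
    simpa [lp.norm_single] using this
  have hF0 : F 0 = φ 0 := by
    rw [← hardyEval_zero, hF, hardyEval_mul hφ _ (by simp), hardyEval_single]
    simp
  have hin : inner ℂ (lp.single 2 0 c) F = inner ℂ c (φ 0) := by
    rw [lp.inner_single_left, hF0]
  rw [norm_sub_rev, @norm_sub_sq ℂ, hin, lp.norm_single (by norm_num), hc]
  have h2 : RCLike.re (inner ℂ c (φ 0)) = 1 + RCLike.re (inner ℂ c (φ 0 - c)) := by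
    rw [inner_sub_right, map_sub, inner_self_eq_norm_sq, hc]; ring
  have h3 : -‖φ 0 - c‖ ≤ RCLike.re (inner ℂ c (φ 0 - c)) := by
    have := (abs_le.1 ((RCLike.abs_re_le_norm _).trans (norm_inner_le_norm (𝕜 := ℂ) c (φ 0 - c)))).1
    rwa [hc, one_mul] at this
  have h4 : ‖F‖ ^ 2 ≤ 1 := pow_le_one₀ (norm_nonneg _) hF1
  rw [h2]
  linarith

/-- Contractive multipliers that converge at the origin to a unimodular constant converge
strongly. -/
theorem hardyMul_tendsto_const {φ : ℕ → ℂ → ℂ} (hφ : ∀ n, IsHInfty (φ n))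
    (h1 : ∀ n, ∀ z ∈ ball (0 : ℂ) 1, ‖φ n z‖ ≤ 1) {c : ℂ} (hc : ‖c‖ = 1)
    (h0 : Tendsto (fun n => φ n 0) atTop (𝓝 c)) (f : Hardy2) :
    Tendsto (fun n => hardyMul (hφ n) f) atTop (𝓝 (c • f)) := by
  -- The vectors where convergence holds form a shift-invariant subspace, closed by equicontinuity
  -- of contractions, so the constant `1` suffices.
  let M : Submodule ℂ Hardy2 :=
    { carrier := {f | Tendsto (fun n => hardyMul (hφ n) f) atTop (𝓝 (c • f))}
      add_mem' := fun {f g} hf hg => by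
        have := Tendsto.add hf hg
        simpa only [Set.mem_ofPred_eq, map_add, smul_add] using this
      zero_mem' := by simp
      smul_mem' := fun a f hf => by
        have := Tendsto.const_smul hf a
        simpa only [Set.mem_ofPred_eq, map_smul, smul_comm c a] using this }
  have hM : IsClosed (M : Set Hardy2) := by
    refine Equicontinuous.isClosed_setOfPred_tendsto (F := fun n f => hardyMul (hφ n) f)
      (f := fun f => c • f) ?_ (continuous_const_smul c)
    refine UniformEquicontinuous.equicontinuous
      (LipschitzWith.uniformEquicontinuous _ 1 fun n => ?_)
    refine LipschitzWith.of_dist_le_mul fun f g => ?_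
    rw [dist_eq_norm, dist_eq_norm, ← map_sub]
    exact norm_hardyMul_le (hφ n) (h1 n) _
  have : M = ⊤ := by
    refine hardy_invariant_eq_top hM (fun f hf => ?_) ?_
    · have := (hardyShift.continuous.tendsto _).comp hf
      change Tendsto _ _ _
      simpa only [hardyMul_shift, map_smul, Function.comp_def] using this
    · change Tendsto _ _ _
      rw [tendsto_iff_norm_sub_tendsto_zero, ← lp.single_smul, smul_eq_mul, mul_one]
      have h2 : Tendsto (fun n => 2 * ‖φ n 0 - c‖) atTop (𝓝 0) := by
        simpa using (tendsto_iff_norm_sub_tendsto_zero.1 h0).const_mul 2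
      have h3 := (squeeze_zero (fun _ => sq_nonneg _)
        (fun n => norm_hardyMul_sub_const_le (hφ n) (h1 n) hc) h2).sqrt
      simpa [Real.sqrt_sq (norm_nonneg _)] using h3
  exact (this ▸ Submodule.mem_top : f ∈ M)

/-- The integrands are dominated by `|u|` and vanish at a given point as soon as `n ≥ -u`. -/
theorem circleAverage_min_tendsto {u : ℂ → ℝ} (hu : CircleIntegrable u 0 1) :
    Tendsto (fun n : ℕ => Real.circleAverage (fun ζ => min 0 (u ζ + n)) 0 1) atTop (𝓝 0) := by
  have h1 : Tendsto (fun n : ℕ => ∫ t in (0 : ℝ)..2 * Real.pi,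
      min 0 (u (circleMap 0 1 t) + n)) atTop (𝓝 (∫ _ in (0 : ℝ)..2 * Real.pi, (0 : ℝ))) := by
    refine intervalIntegral.tendsto_integral_filter_of_dominated_convergence
      (fun t => ‖u (circleMap 0 1 t)‖) ?_ ?_ (IntervalIntegrable.norm hu) ?_
    · refine Eventually.of_forall fun n => ?_
      have := (intervalIntegrable_iff.1 hu).aestronglyMeasurable
      exact aestronglyMeasurable_const.inf (this.add aestronglyMeasurable_const)
    · refine Eventually.of_forall fun n => ae_of_all _ fun t _ => ?_
      have hn : (0 : ℝ) ≤ n := n.cast_nonneg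
      rw [Real.norm_eq_abs, Real.norm_eq_abs, abs_of_nonpos (min_le_left _ _), neg_le]
      refine le_min (neg_nonpos.2 (abs_nonneg _)) ?_
      linarith [neg_abs_le (u (circleMap 0 1 t))]
    · refine ae_of_all _ fun t _ => ?_
      refine tendsto_const_nhds.congr' ?_
      filter_upwards [eventually_ge_atTop ⌈-u (circleMap 0 1 t)⌉₊] with n hn
      have := Nat.ceil_le.1 hn
      rw [min_eq_left]
      linarith
  simp only [Real.circleAverage_def]
  simpa using h1.const_smul (2 * Real.pi)⁻¹

theorem CircleIntegrable.min_const {u : ℂ → ℝ} (hu : CircleIntegrable u 0 1) (a : ℝ) :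
    CircleIntegrable (fun ζ => min (u ζ) a) 0 1 := by
  simp only [CircleIntegrable, intervalIntegrable_iff] at hu ⊢
  exact hu.inf (integrableOn_const (by simp [Set.uIoc_of_le Real.two_pi_pos.le, -ENNReal.ofReal_mul]))

/-- The multiples of a bounded outer function approximate every vector. -/
theorem IsOuter.exists_hardyMul_tendsto {g : ℂ → ℂ} (hg : IsHInfty g) (ho : IsOuter g) :
    ∃ c : ℂ, c ≠ 0 ∧ ∃ (h : ℕ → ℂ → ℂ) (hh : ∀ n, IsHInfty (h n)), ∀ f,
      Tendsto (fun n => hardyMul (hh n) (hardyMul hg f)) atTop (𝓝 (c • f)) := by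
  obtain ⟨c, u, hc, hu, hgu⟩ := ho
  -- The inverse of `g` would come from `-u`; cutting it at height `n` gives a bounded function. The
  -- product with `g` then comes from `min 0 (u + n) ≤ 0`, so it is a contractive multiplier.
  have hm : ∀ n : ℕ, CircleIntegrable (fun ζ => min (-u ζ) n) 0 1 := fun n => hu.neg.min_const n
  have hh : ∀ n : ℕ, IsHInfty fun z => Complex.exp (herglotzIntegral (fun ζ => min (-u ζ) n) z) :=
    fun n => isHInfty_exp_herglotzIntegral (hm n) fun ζ => min_le_right _ _
  have hsum : ∀ n : ℕ, ∀ ζ, u ζ + min (-u ζ) n = min 0 (u ζ + n) := fun n ζ => by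
    rw [← min_add_add_left, add_neg_cancel]
  have hprod : ∀ n : ℕ, ∀ z ∈ ball (0 : ℂ) 1,
      Complex.exp (herglotzIntegral (fun ζ => min (-u ζ) n) z) * g z =
        c * Complex.exp (herglotzIntegral (fun ζ => min 0 (u ζ + n)) z) := by
    intro n z hz
    rw [hgu z hz, ← herglotzIntegral]
    simp only [← hsum]
    rw [herglotzIntegral_add hu (hm n) hz, Complex.exp_add]
    ring
  have hmi : ∀ n : ℕ, CircleIntegrable (fun ζ => min 0 (u ζ + n)) 0 1 := by
    intro n
    have := hu.add (hm n)
    simp only [← hsum]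
    exact this
  refine ⟨c, fun h => by simp [h] at hc, _, hh, fun f => ?_⟩
  have h1 : ∀ n : ℕ, ∀ z ∈ ball (0 : ℂ) 1,
      ‖Complex.exp (herglotzIntegral (fun ζ => min (-u ζ) n) z) * g z‖ ≤ 1 := by
    intro n z hz
    rw [hprod n z hz, norm_mul, hc, one_mul, Complex.norm_exp, Real.exp_le_one_iff]
    exact herglotzIntegral_re_le (hmi n) (fun ζ => min_le_left _ _) hz
  -- At the origin the Herglotz integral is the mean of `min 0 (u + n)`, which tends to `0`; hence
  -- the products tend there to `c`.
  have h2 := hardyMul_tendsto_const (fun n => (hh n).mul hg) h1 hc (by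
    refine Tendsto.congr (fun n => (hprod n 0 (mem_ball_self one_pos)).symm) ?_
    simp only [herglotzIntegral_zero]
    have h3 := (Complex.continuous_exp.tendsto _).comp
      ((Complex.continuous_ofReal.tendsto _).comp (circleAverage_min_tendsto hu))
    simpa [Function.comp_def] using h3.const_mul c) f
  refine h2.congr fun n => hardyMul_eq _ fun z hz => ?_
  rw [hardyEval_mul _ _ hz, hardyEval_mul _ _ hz]
  ring

theorem IsOuter.denseRange_hardyMul {g : ℂ → ℂ} (hg : IsHInfty g) (ho : IsOuter g) :
    DenseRange (hardyMul hg) := by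
  obtain ⟨c, hc, h, hh, ht⟩ := ho.exists_hardyMul_tendsto hg
  intro f
  have := ht (c⁻¹ • f)
  rw [smul_inv_smul₀ hc] at this
  refine mem_closure_of_tendsto this (Eventually.of_forall fun n => ?_)
  exact ⟨hardyMul (hh n) (c⁻¹ • f), hardyMul_comm _ _ _⟩

/-- An outer function has no common divisor with an inner function. -/
theorem IsOuter.mem_innerRange {g θ : ℂ → ℂ} (hg : IsHInfty g) (ho : IsOuter g) (hθ : IsInner θ)
    {f : Hardy2} (hf : hardyMul hg f ∈ innerRange θ) : f ∈ innerRange θ := by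
  obtain ⟨c, hc, h, hh, ht⟩ := ho.exists_hardyMul_tendsto hg
  -- The vectors `h n * g * f` stay in the closed multiplier-invariant space `θH²` and converge to
  -- `c f`.
  have := (innerRange_isClosed hθ).mem_of_tendsto (ht f)
    (Eventually.of_forall fun n => hardyMul_mem_innerRange (hh n) hf)
  exact (Submodule.smul_mem_iff _ hc).1 this

/-! ### Jensen's inequality and the mean of `|log |f||`. -/

theorem hardyEval_analyticOnNhd (f : Hardy2) : AnalyticOnNhd ℂ (hardyEval f) (ball 0 1) :=
  (hardyEval_differentiableOn f).analyticOnNhd isOpen_ball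

/-- Jensen's inequality for analytic functions. -/
theorem AnalyticOnNhd.log_norm_le_circleAverage {f : ℂ → ℂ} {r : ℝ} (hr : 0 < r)
    (hf : AnalyticOnNhd ℂ f (closedBall 0 r)) (h0 : f 0 ≠ 0) :
    Real.log ‖f 0‖ ≤ Real.circleAverage (fun z => Real.log ‖f z‖) 0 r := by
  rw [← abs_of_pos hr] at hf
  rw [AnalyticOnNhd.circleAverage_log_norm hr.ne' hf h0]
  -- In Jensen's formula a point `u` of the disk contributes its multiplicity times `log (r / |u|) ≥
  -- 0`; at `u = 0` the logarithm is `log 0 = 0` by convention.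
  refine le_add_of_nonneg_left (finsum_nonneg fun u => ?_)
  by_cases hu : u ∈ closedBall (0 : ℂ) |r|
  · refine mul_nonneg (by exact_mod_cast MeromorphicOn.AnalyticOnNhd.divisor_nonneg hf u) ?_
    rw [abs_of_pos hr, mem_closedBall_zero_iff] at hu
    rcases eq_or_ne u 0 with rfl | hu0
    · simp
    · refine Real.log_nonneg ?_
      rw [zero_sub, norm_neg, ← div_eq_mul_inv, one_le_div (norm_pos_iff.2 hu0)]
      exact hu
  · simp [MeromorphicOn.divisor, hu]

/-- Use `|x| = 2 max x 0 - x`, `log |w| ≤ |w - 1|` and `2t ≤ ε⁻¹ t ^ 2 + ε`. The right side can be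
averaged: the square is controlled by the `H²` norm, and Jensen bounds the mean of the signed
logarithm from below. -/
theorem abs_log_norm_le (w : ℂ) {ε : ℝ} (hε : 0 < ε) :
    |Real.log ‖w‖| ≤ ε⁻¹ * ‖w - 1‖ ^ 2 + ε - Real.log ‖w‖ := by
  have h2 : 2 * ‖w - 1‖ ≤ ε⁻¹ * ‖w - 1‖ ^ 2 + ε := by
    have h3 : ε⁻¹ * ‖w - 1‖ ^ 2 + ε - 2 * ‖w - 1‖ = ε⁻¹ * (‖w - 1‖ - ε) ^ 2 := by
      field_simp
      ring
    have : 0 ≤ ε⁻¹ * (‖w - 1‖ - ε) ^ 2 := by positivity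
    linarith
  rcases le_total 0 (Real.log ‖w‖) with h | h
  · rw [abs_of_nonneg h]
    have h4 : ‖w‖ ≤ ‖w - 1‖ + 1 := by simpa using norm_add_le (w - 1) 1
    have h5 : Real.log ‖w‖ ≤ ‖w - 1‖ := by
      rcases eq_or_ne w 0 with rfl | hw
      · simp
      · linarith [Real.log_le_sub_one_of_pos (norm_pos_iff.2 hw)]
    linarith
  · rw [abs_of_nonpos h]
    have := norm_nonneg (w - 1)
    linarith

theorem hardy_circleAverage_sq_le (f : Hardy2) {r : ℝ} (h0 : 0 ≤ r) (h1 : r < 1) :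
    Real.circleAverage (fun z => ‖hardyEval f z‖ ^ 2) 0 r ≤ ‖f‖ ^ 2 := by
  rw [Real.circleAverage_def, smul_eq_mul]
  refine hasSum_le (fun n => ?_) (hardy_mean f h0 h1) (hardy_hasSum_sq f)
  have : r ^ n ≤ 1 := pow_le_one₀ h0 h1.le
  have : ‖f n‖ * r ^ n ≤ ‖f n‖ := mul_le_of_le_one_right (norm_nonneg _) this
  gcongr

/-- If `f` is close to `1` in `H²`, then `log |f|` is close to `0` in the mean on all circles. -/
theorem hardy_circleAverage_abs_log_le {f : Hardy2} {ε : ℝ} (hε : 0 < ε) (hε1 : ε ≤ 1 / 2)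
    (hf : ‖f - lp.single 2 0 1‖ ≤ ε) {r : ℝ} (h0 : 0 < r) (h1 : r < 1) :
    Real.circleAverage (fun z => |Real.log ‖hardyEval f z‖|) 0 r ≤ 4 * ε := by
  have hsub : closedBall (0 : ℂ) r ⊆ ball 0 1 := closedBall_subset_ball h1
  have han : AnalyticOnNhd ℂ (hardyEval f) (closedBall 0 r) :=
    (hardyEval_analyticOnNhd f).mono hsub
  have hlog : CircleIntegrable (fun z => Real.log ‖hardyEval f z‖) 0 r :=
    MeromorphicOn.circleIntegrable_log_norm_of_nonneg
      (han.mono sphere_subset_closedBall).meromorphicOn h0.le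
  have he : ∀ z ∈ sphere (0 : ℂ) |r|,
      hardyEval (f - lp.single 2 0 1) z = hardyEval f z - 1 := fun z hz => by
    have hz' : ‖z‖ < 1 := by
      rw [mem_sphere_zero_iff_norm, abs_of_pos h0] at hz
      rwa [hz]
    rw [hardyEval_sub _ _ hz', hardyEval_single]
    simp
  have hsq : CircleIntegrable (fun z => ε⁻¹ * ‖hardyEval (f - lp.single 2 0 1) z‖ ^ 2) 0 r := by
    have : Continuous fun t : ℝ =>
        ε⁻¹ * ‖hardyEval (f - lp.single 2 0 1) (circleMap 0 r t)‖ ^ 2 :=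
      ((hardyEval_continuousOn _ h0.le h1).norm.pow 2).const_mul _
    exact this.intervalIntegrable _ _
  have hcst : CircleIntegrable (fun _ : ℂ => ε) 0 r := circleIntegrable_const _ _ _
  have hsum := (hsq.add hcst)
  -- The total `4ε` consists of `ε` from the square, `ε` from the constant and `2ε` from `-log |f
  -- 0|`, because `|f 0| ≥ 1 - ε` and `ε ≤ 1 / 2`.
  have hmono : Real.circleAverage (fun z => |Real.log ‖hardyEval f z‖|) 0 r ≤
      Real.circleAverage (fun z => ε⁻¹ * ‖hardyEval (f - lp.single 2 0 1) z‖ ^ 2 + ε -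
        Real.log ‖hardyEval f z‖) 0 r := by
    refine Real.circleAverage_mono hlog.abs (hsum.sub hlog) fun z hz => ?_
    rw [he z hz]
    exact abs_log_norm_le _ hε
  have h3 : Real.circleAverage (fun z => ε⁻¹ * ‖hardyEval (f - lp.single 2 0 1) z‖ ^ 2 + ε -
        Real.log ‖hardyEval f z‖) 0 r =
      ε⁻¹ * Real.circleAverage (fun z => ‖hardyEval (f - lp.single 2 0 1) z‖ ^ 2) 0 r + ε -
        Real.circleAverage (fun z => Real.log ‖hardyEval f z‖) 0 r := by
    have h4 := Real.circleAverage_fun_sub hsum hlog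
    have h5 := Real.circleAverage_fun_add hsq hcst
    have h6 := Real.circleAverage_fun_smul (a := ε⁻¹) (c := 0) (R := r)
      (f := fun z => ‖hardyEval (f - lp.single 2 0 1) z‖ ^ 2)
    simp only [smul_eq_mul] at h6
    rw [h6, Real.circleAverage_const] at h5
    rw [← h5]
    exact h4
  have h7 : ε⁻¹ * Real.circleAverage (fun z => ‖hardyEval (f - lp.single 2 0 1) z‖ ^ 2) 0 r ≤
      ε := by
    rw [inv_mul_le_iff₀ hε, ← sq]
    exact (hardy_circleAverage_sq_le _ h0.le h1).trans (by gcongr)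
  have h8 : 1 - ε ≤ ‖hardyEval f 0‖ := by
    have h9 := (hardy_coeff_le (f - lp.single 2 0 1) 0).trans hf
    rw [lp.coeFn_sub, Pi.sub_apply, lp.single_apply_self] at h9
    rw [hardyEval_zero]
    have := norm_sub_norm_le (1 : ℂ) (f 0)
    rw [norm_one, norm_sub_rev] at this
    linarith
  have h9 : -(2 * ε) ≤ Real.log ‖hardyEval f 0‖ := by
    have hpos : 0 < 1 - ε := by linarith
    refine le_trans ?_ (Real.log_le_log hpos h8)
    refine le_trans ?_ (Real.one_sub_inv_le_log_of_pos hpos)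
    have : (1 - ε)⁻¹ ≤ 1 + 2 * ε := by
      rw [inv_le_iff_one_le_mul₀ hpos]
      nlinarith
    linarith
  have h10 := han.log_norm_le_circleAverage h0 (norm_pos_iff.1 (by linarith))
  linarith

/-! ### Zero-free approximate inverses of a cyclic multiplier. -/

/-- Zeros in a smaller closed disk are finite in number, so only finitely many radii meet one. -/
theorem hardy_exists_radius {f : Hardy2} (hf : f ≠ 0) {a : ℝ} (ha : a < 1) :
    ∃ ρ : ℝ, 0 < ρ ∧ a < ρ ∧ ρ < 1 ∧ ∀ z : ℂ, ‖z‖ = ρ → hardyEval f z ≠ 0 := by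
  obtain ⟨b, hab, hb⟩ := exists_between (max_lt ha one_pos)
  have hfin : ({z ∈ closedBall (0 : ℂ) b | hardyEval f z = 0}).Finite := by
    by_contra hinf
    obtain ⟨x, hx, hacc⟩ := Set.Infinite.exists_accPt_of_subset_isCompact hinf
      (isCompact_closedBall (0 : ℂ) b) fun z hz => hz.1
    have hfr := (accPt_iff_frequently_nhdsNE.1 hacc).mono fun z hz => hz.2
    have h0 := (hardyEval_analyticOnNhd f).eqOn_zero_of_preconnected_of_frequently_eq_zero
      (convex_ball _ _).isPreconnected (closedBall_subset_ball hb hx) hfr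
    exact hf (hardyEval_ext fun z hz => by rw [h0 hz]; simp [hardyEval])
  obtain ⟨ρ, hρ, hρ2⟩ := ((Set.Ioo_infinite hab).sdiff (hfin.image norm)).nonempty
  refine ⟨ρ, (le_max_right _ _).trans_lt hρ.1, (le_max_left _ _).trans_lt hρ.1,
    hρ.2.trans hb, fun z hz h => hρ2 ⟨z, ⟨?_, h⟩, hz⟩⟩
  rw [mem_closedBall_zero_iff, hz]
  exact hρ.2.le

/-- A zero of `g` would confine the range to the kernel of a point evaluation, which is closed and
misses `1`. -/
theorem hardyMul_ne_zero {g : ℂ → ℂ} (hg : IsHInfty g) (hd : DenseRange (hardyMul hg)) {z : ℂ}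
    (hz : z ∈ ball (0 : ℂ) 1) : g z ≠ 0 := by
  intro h
  have hz' : ‖z‖ < 1 := by simpa using hz
  have hcl : IsClosed {f | hardyEvalCLM hz' f = 0} :=
    isClosed_eq (hardyEvalCLM hz').continuous continuous_const
  have h1 : lp.single 2 0 (1 : ℂ) ∈ {f | hardyEvalCLM hz' f = 0} := by
    refine closure_minimal ?_ hcl (hd _)
    rintro _ ⟨f, rfl⟩
    change hardyEval _ z = 0
    rw [hardyEval_mul hg f hz, h, zero_mul]
  have h2 : hardyEval (lp.single 2 0 (1 : ℂ)) z = 0 := h1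
  rw [hardyEval_single] at h2
  simp at h2

/-- Approximate inverses of a cyclic multiplier which are continuous on the closed disk and have no
zeros near the unit circle. -/
theorem hardyMul_exists_approx_inverse {g : ℂ → ℂ} (hg : IsHInfty g)
    (hd : DenseRange (hardyMul hg)) {ε : ℝ} (hε : 0 < ε) (hε1 : ε ≤ 1 / 2) :
    ∃ q : Hardy2, ‖hardyMul hg q - lp.single 2 0 1‖ ≤ ε ∧ ∃ a : ℝ, 0 < a ∧ a < 1 ∧
      ContinuousOn (hardyEval q) {z | ‖z‖ ∈ Set.Icc a 1} ∧
      ∀ z, ‖z‖ ∈ Set.Icc a 1 → hardyEval q z ≠ 0 := by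
  obtain ⟨f, hf⟩ := hd.exists_dist_lt (lp.single 2 0 (1 : ℂ)) hε
  rw [dist_eq_norm, norm_sub_rev] at hf
  have hf0 : f ≠ 0 := by
    rintro rfl
    rw [map_zero, zero_sub, norm_neg, lp.norm_single (by norm_num), norm_one] at hf
    linarith
  -- Take for `q` a dilation of `f` by `ρ` near `1`, with no zero of `f` on the circle of radius
  -- `ρ`; compactness extends this to a neighbourhood.
  have ht : Tendsto (fun r : ℝ => ‖hardyMul hg (hardyDilate r f) - lp.single 2 0 1‖) (𝓝[<] 1)
      (𝓝 ‖hardyMul hg f - lp.single 2 0 1‖) :=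
    ((((hardyMul hg).continuous.tendsto f).comp (hardyDilate_tendsto f)).sub_const _).norm
  obtain ⟨b, hb, hb2⟩ := mem_nhdsLT_iff_exists_Ioo_subset.1 (ht.eventually_lt_const hf)
  obtain ⟨ρ, hρ0, hbρ, hρ1, hne⟩ := hardy_exists_radius hf0 hb
  refine ⟨hardyDilate ρ f, (hb2 ⟨hbρ, hρ1⟩ : _ < _).le, ?_⟩
  have hopen : IsOpen (ball (0 : ℂ) 1 ∩ hardyEval f ⁻¹' {0}ᶜ) :=
    (hardyEval_differentiableOn f).continuousOn.isOpen_inter_preimage isOpen_ball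
      isOpen_compl_singleton
  obtain ⟨δ, hδ, hsub⟩ := (isCompact_sphere (0 : ℂ) ρ).exists_thickening_subset_open hopen
    fun z hz => by
      rw [mem_sphere_zero_iff_norm] at hz
      exact ⟨by rw [mem_ball_zero_iff, hz]; exact hρ1, hne z hz⟩
  -- The point `ρz` is within `ρ (1 - |z|) < δ` of `ρz / |z|` on the circle; the bound `1 / 2` keeps
  -- `z` away from `0`.
  have hmem : ∀ z : ℂ, ‖z‖ ∈ Set.Icc (max (1 / 2) (1 - δ / 2)) 1 →
      (ρ : ℂ) * z ∈ ball (0 : ℂ) 1 ∩ hardyEval f ⁻¹' {0}ᶜ := by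
    intro z hz
    have hz0 : 0 < ‖z‖ := lt_of_lt_of_le (by norm_num) ((le_max_left _ _).trans hz.1)
    refine hsub (mem_thickening_iff.2 ⟨ρ * (z / ‖z‖), ?_, ?_⟩)
    · simp [hz0.ne', abs_of_pos hρ0]
    · rw [dist_eq_norm, show (ρ : ℂ) * z - ρ * (z / ‖z‖) = (ρ : ℂ) * (z / ‖z‖) * ((‖z‖ - 1 : ℝ) : ℂ)
        by
          have : (‖z‖ : ℂ) ≠ 0 := by exact_mod_cast hz0.ne'
          push_cast
          field_simp]
      rw [norm_mul, norm_mul, norm_div, Complex.norm_real, Complex.norm_real, Complex.norm_real,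
        norm_norm, div_self hz0.ne', mul_one, Real.norm_of_nonneg hρ0.le, Real.norm_eq_abs,
        abs_of_nonpos (by linarith [hz.2])]
      have := (le_max_right (1 / 2) (1 - δ / 2)).trans hz.1
      nlinarith [hz.2]
  refine ⟨max (1 / 2) (1 - δ / 2), lt_of_lt_of_le (by norm_num) (le_max_left _ _),
    max_lt (by norm_num) (by linarith), ?_, fun z hz => ?_⟩
  · rw [show hardyEval (hardyDilate ρ f) = fun z => hardyEval f (ρ * z) from
      funext fun z => hardyEval_dilate hρ0.le hρ1.le f z]
    exact (hardyEval_differentiableOn f).continuousOn.comp (by fun_prop) fun z hz => (hmem z hz).1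
  · rw [hardyEval_dilate hρ0.le hρ1.le]
    exact (hmem z hz).2

/-! ### `L¹` of the unit circle. -/

/-- Arc length measure on the unit circle, as a measure on the plane. -/
noncomputable def circleMeasure : Measure ℂ :=
  Measure.map (circleMap 0 1) (volume.restrict (Set.Ioc 0 (2 * Real.pi)))

theorem aemeasurable_circleMap :
    AEMeasurable (circleMap 0 1) (volume.restrict (Set.Ioc 0 (2 * Real.pi))) :=
  (continuous_circleMap 0 1).measurable.aemeasurable

theorem ContinuousOn.aestronglyMeasurable_circleMeasure {f : ℂ → ℝ}
    (hf : ContinuousOn f (sphere 0 1)) : AEStronglyMeasurable f circleMeasure := by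
  have h1 : ∀ᵐ z ∂circleMeasure, z ∈ sphere (0 : ℂ) 1 := by
    refine (ae_map_iff (p := (· ∈ sphere (0 : ℂ) 1)) aemeasurable_circleMap
      isClosed_sphere.measurableSet).2 (ae_of_all _ fun t => by simp)
  rw [← Measure.restrict_eq_self_of_ae_mem h1]
  exact hf.aestronglyMeasurable isClosed_sphere.measurableSet

theorem integrable_circleMeasure_iff {f : ℂ → ℝ} (hf : AEStronglyMeasurable f circleMeasure) :
    Integrable f circleMeasure ↔ CircleIntegrable f 0 1 := by
  rw [circleMeasure, integrable_map_measure hf aemeasurable_circleMap, CircleIntegrable,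
    intervalIntegrable_iff_integrableOn_Ioc_of_le Real.two_pi_pos.le]
  rfl

theorem circleAverage_eq_integral_circleMeasure {f : ℂ → ℝ}
    (hf : AEStronglyMeasurable f circleMeasure) :
    Real.circleAverage f 0 1 = (2 * Real.pi)⁻¹ * ∫ z, f z ∂circleMeasure := by
  rw [Real.circleAverage_def, circleMeasure, integral_map aemeasurable_circleMap hf,
    intervalIntegral.integral_of_le Real.two_pi_pos.le, smul_eq_mul]

/-- Completeness of `L¹` of the unit circle. -/
theorem circleIntegrable_complete {f : ℕ → ℂ → ℝ} (hc : ∀ n, ContinuousOn (f n) (sphere 0 1))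
    (hf : ∀ ε > 0, ∃ N, ∀ m ≥ N, ∀ n ≥ N,
      Real.circleAverage (fun ζ => |f m ζ - f n ζ|) 0 1 ≤ ε) :
    ∃ u : ℂ → ℝ, CircleIntegrable u 0 1 ∧
      Tendsto (fun n => Real.circleAverage (fun ζ => |f n ζ - u ζ|) 0 1) atTop (𝓝 0) := by
  have hm := fun n => (hc n).aestronglyMeasurable_circleMeasure
  have hi : ∀ n, Integrable (f n) circleMeasure := fun n =>
    (integrable_circleMeasure_iff (hm n)).2 ((hc n).circleIntegrable zero_le_one)
  -- Up to the factor `(2π)⁻¹`, the mean of `|h|` is the norm of the class of `h` in `L¹`, which is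
  -- complete.
  have hnorm : ∀ {h : ℂ → ℝ} (hh : Integrable h circleMeasure),
      Real.circleAverage (fun ζ => |h ζ|) 0 1 = (2 * Real.pi)⁻¹ * ‖hh.toL1 h‖ := by
    intro h hh
    rw [circleAverage_eq_integral_circleMeasure hh.abs.aestronglyMeasurable,
      L1.norm_eq_integral_norm]
    congr 1
    refine integral_congr_ae ?_
    filter_upwards [hh.coeFn_toL1] with z hz
    rw [hz, Real.norm_eq_abs]
  have hdiff : ∀ {h k : ℂ → ℝ} (hh : Integrable h circleMeasure) (hk : Integrable k circleMeasure),
      Real.circleAverage (fun ζ => |h ζ - k ζ|) 0 1 =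
        (2 * Real.pi)⁻¹ * dist (hh.toL1 h) (hk.toL1 k) := by
    intro h k hh hk
    rw [dist_eq_norm, ← Integrable.toL1_sub, ← hnorm]
    rfl
  have hcs : CauchySeq fun n => (hi n).toL1 (f n) := by
    rw [Metric.cauchySeq_iff]
    intro ε hε
    obtain ⟨N, hN⟩ := hf ((2 * Real.pi)⁻¹ * (ε / 2)) (by have := Real.pi_pos; positivity)
    refine ⟨N, fun m hm n hn => ?_⟩
    have := hN m hm n hn
    rw [hdiff (hi m) (hi n), mul_le_mul_iff_right₀ (inv_pos.2 Real.two_pi_pos)] at this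
    linarith
  obtain ⟨U, hU⟩ := cauchySeq_tendsto_of_complete hcs
  refine ⟨U, (integrable_circleMeasure_iff (L1.integrable_coeFn U).aestronglyMeasurable).1
    (L1.integrable_coeFn U), ?_⟩
  simp only [hdiff (hi _) (L1.integrable_coeFn U), Integrable.toL1_coeFn]
  simpa using (tendsto_iff_dist_tendsto_zero.1 hU).const_mul (2 * Real.pi)⁻¹

/-! ### Boundary values of `log |g|`: cyclic multipliers are outer. -/

theorem ofReal_mul_mem_ball {r : ℝ} (h0 : 0 ≤ r) (h1 : r < 1) {ζ : ℂ}
    (hζ : ζ ∈ closedBall (0 : ℂ) 1) : (r : ℂ) * ζ ∈ ball (0 : ℂ) 1 := by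
  rw [mem_closedBall_zero_iff] at hζ
  rw [mem_ball_zero_iff, norm_mul, Complex.norm_real, Real.norm_of_nonneg h0]
  nlinarith [norm_nonneg ζ]

theorem log_norm_dilate_continuousOn {g : ℂ → ℂ} (hg : DifferentiableOn ℂ g (ball 0 1))
    (hne : ∀ z ∈ ball (0 : ℂ) 1, g z ≠ 0) {r : ℝ} (h0 : 0 ≤ r) (h1 : r < 1) :
    ContinuousOn (fun ζ => Real.log ‖g (r * ζ)‖) (sphere 0 1) := by
  have hm : ∀ ζ ∈ sphere (0 : ℂ) 1, (r : ℂ) * ζ ∈ ball (0 : ℂ) 1 := fun ζ hζ =>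
    ofReal_mul_mem_ball h0 h1 (sphere_subset_closedBall hζ)
  exact ((hg.continuousOn.comp (by fun_prop) hm).norm).log
    fun ζ hζ => norm_ne_zero_iff.2 (hne _ (hm ζ hζ))

/-- For a cyclic multiplier `g`, the functions `log |g (rζ)|` are, near the unit circle, uniformly
approximable in the mean. -/
theorem hardyMul_exists_log_approx {g : ℂ → ℂ} (hg : IsHInfty g) (hd : DenseRange (hardyMul hg))
    {ε : ℝ} (hε : 0 < ε) (hε1 : ε ≤ 1 / 2) :
    ∃ L : ℂ → ℝ, ContinuousOn L (sphere 0 1) ∧ ∃ a < 1, ∀ r : ℝ, a < r → r < 1 →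
      Real.circleAverage (fun ζ => |Real.log ‖g (r * ζ)‖ + L ζ|) 0 1 ≤ 5 * ε := by
  obtain ⟨q, hq, a, ha0, ha1, hqc, hqne⟩ := hardyMul_exists_approx_inverse hg hd hε hε1
  have hne : ∀ z ∈ ball (0 : ℂ) 1, g z ≠ 0 := fun z hz => hardyMul_ne_zero hg hd hz
  have hlc : ContinuousOn (fun z => Real.log ‖hardyEval q z‖) {z | ‖z‖ ∈ Set.Icc a 1} :=
    hqc.norm.log fun z hz => norm_ne_zero_iff.2 (hqne z hz)
  have hproj : ContinuousOn (fun z : ℂ => z / ‖z‖) {z | ‖z‖ ∈ Set.Icc a 1} := by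
    refine ContinuousOn.div continuousOn_id (by fun_prop) fun z hz => ?_
    exact_mod_cast (ha0.trans_le hz.1).ne'
  have hproj1 : ∀ z ∈ {z : ℂ | ‖z‖ ∈ Set.Icc a 1}, z / ‖z‖ ∈ {z : ℂ | ‖z‖ ∈ Set.Icc a 1} := by
    intro z hz
    have : ‖z‖ ≠ 0 := (ha0.trans_le hz.1).ne'
    simp [this, ha1.le]
  -- `F` compares `log |q|` at `z` with its value at the radial projection. It is continuous on the
  -- annulus and zero on the unit circle, so its means tend to `0`.
  set F : ℂ → ℝ := fun z =>
    |Real.log ‖hardyEval q z‖ - Real.log ‖hardyEval q (z / ‖z‖)‖| with hF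
  have hFc : ContinuousOn F {z | ‖z - 0‖ ∈ Set.Icc a 1} := by
    simp only [sub_zero]
    exact (hlc.sub (hlc.comp hproj hproj1)).abs
  have hav := Real.ContinuousOn.circleAverage hFc fun r hr => ha0.le.trans hr.1
  have hav1 : Real.circleAverage F 0 1 = 0 := by
    rw [Real.circleAverage_const_on_circle (a := 0)]
    intro z hz
    have : ‖z‖ = 1 := by simpa using hz
    simp [hF, this]
  have hlt : ∀ᶠ r in 𝓝[<] (1 : ℝ), Real.circleAverage F 0 r < ε := by
    have h1 := (hav 1 ⟨ha1.le, le_rfl⟩).tendsto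
    rw [hav1] at h1
    refine (h1.eventually_lt_const hε).filter_mono ?_
    refine nhdsWithin_le_iff.2 ?_
    filter_upwards [Ioo_mem_nhdsLT ha1] with r hr using ⟨hr.1.le, hr.2.le⟩
  obtain ⟨b, hb, hb2⟩ := mem_nhdsLT_iff_exists_Ioo_subset.1 hlt
  have hS : sphere (0 : ℂ) 1 ⊆ {z | ‖z‖ ∈ Set.Icc a 1} := fun z hz => by
    rw [mem_sphere_zero_iff_norm] at hz
    simp [hz, ha1.le]
  -- As `g q` is close to `1`, `log |q|` on the unit circle nearly cancels `log |g|`. Passing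
  -- through `log |q (rζ)|` costs `4ε` for `g q` on radius `r` and `ε` for moving `q` to the
  -- boundary.
  refine ⟨fun z => Real.log ‖hardyEval q z‖, hlc.mono hS, max a b, max_lt ha1 hb,
    fun r hr hr1 => ?_⟩
  have har : a < r := (le_max_left _ _).trans_lt hr
  have hr0 : 0 < r := ha0.trans har
  have hmr : ∀ ζ ∈ sphere (0 : ℂ) 1, (r : ℂ) * ζ ∈ {z : ℂ | ‖z‖ ∈ Set.Icc a 1} := fun ζ hζ => by
    rw [mem_sphere_zero_iff_norm] at hζ
    simp [hζ, abs_of_pos hr0, har.le, hr1.le]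
  have h1 := hardy_circleAverage_abs_log_le hε hε1 hq hr0 hr1
  rw [Real.circleAverage_eq_circleAverage_zero_one] at h1
  have h2 : Real.circleAverage F 0 r < ε := hb2 ⟨(le_max_right _ _).trans_lt hr, hr1⟩
  rw [Real.circleAverage_eq_circleAverage_zero_one] at h2
  simp only [add_zero] at h1 h2
  have hgc := log_norm_dilate_continuousOn hg.1 hne hr0.le hr1
  have hlr : ContinuousOn (fun ζ : ℂ => Real.log ‖hardyEval q (r * ζ)‖) (sphere 0 1) :=
    hlc.comp (by fun_prop) hmr
  have hi1 : CircleIntegrable (fun ζ => |Real.log ‖g (r * ζ)‖ +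
      Real.log ‖hardyEval q (r * ζ)‖|) 0 1 := (hgc.add hlr).abs.circleIntegrable zero_le_one
  have hi2 : CircleIntegrable (fun ζ => |Real.log ‖hardyEval q (r * ζ)‖ -
      Real.log ‖hardyEval q ζ‖|) 0 1 :=
    (hlr.sub (hlc.mono hS)).abs.circleIntegrable zero_le_one
  have hi3 : CircleIntegrable (fun ζ => |Real.log ‖g (r * ζ)‖ + Real.log ‖hardyEval q ζ‖|) 0 1 :=
    (hgc.add (hlc.mono hS)).abs.circleIntegrable zero_le_one
  have e1 : Real.circleAverage (fun ζ => |Real.log ‖g (r * ζ)‖ +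
      Real.log ‖hardyEval q (r * ζ)‖|) 0 1 ≤ 4 * ε := by
    refine le_trans (le_of_eq ?_) h1
    refine Real.circleAverage_congr_sphere fun ζ hζ => ?_
    rw [abs_one] at hζ
    have hb := ofReal_mul_mem_ball hr0.le hr1 (sphere_subset_closedBall hζ)
    rw [hardyEval_mul hg q hb, norm_mul, Real.log_mul (norm_ne_zero_iff.2 (hne _ hb))
      (norm_ne_zero_iff.2 (hqne _ (hmr ζ hζ)))]
  have e2 : Real.circleAverage (fun ζ => |Real.log ‖hardyEval q (r * ζ)‖ -
      Real.log ‖hardyEval q ζ‖|) 0 1 < ε := by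
    refine lt_of_eq_of_lt ?_ h2
    refine Real.circleAverage_congr_sphere fun ζ hζ => ?_
    rw [abs_one, mem_sphere_zero_iff_norm] at hζ
    have : (r : ℂ) ≠ 0 := by exact_mod_cast hr0.ne'
    simp [hF, hζ, abs_of_pos hr0, this]
  calc _ ≤ Real.circleAverage (fun ζ => |Real.log ‖g (r * ζ)‖ +
      Real.log ‖hardyEval q (r * ζ)‖| + |Real.log ‖hardyEval q (r * ζ)‖ -
      Real.log ‖hardyEval q ζ‖|) 0 1 := by
        refine Real.circleAverage_mono hi3 (hi1.add hi2) fun ζ _ => ?_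
        refine le_trans (le_of_eq ?_) (abs_sub _ _)
        congr 1
        ring
    _ = _ := Real.circleAverage_fun_add hi1 hi2
    _ ≤ 5 * ε := by linarith

/-- The boundary values of `log |g|`, for a cyclic multiplier `g`. -/
theorem hardyMul_exists_log_boundary {g : ℂ → ℂ} (hg : IsHInfty g) (hd : DenseRange (hardyMul hg))
    {r : ℕ → ℝ} (hr0 : ∀ n, 0 ≤ r n) (hr1 : ∀ n, r n < 1) (hr : Tendsto r atTop (𝓝 1)) :
    ∃ u : ℂ → ℝ, CircleIntegrable u 0 1 ∧ Tendsto (fun n => Real.circleAverage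
      (fun ζ => |Real.log ‖g (r n * ζ)‖ - u ζ|) 0 1) atTop (𝓝 0) := by
  have hne : ∀ z ∈ ball (0 : ℂ) 1, g z ≠ 0 := fun z hz => hardyMul_ne_zero hg hd hz
  have hc := fun n => log_norm_dilate_continuousOn hg.1 hne (hr0 n) (hr1 n)
  refine circleIntegrable_complete hc fun ε hε => ?_
  -- `L` does not depend on the radius, so two radii near `1` differ by twice `5 (ε / 10)`.
  obtain ⟨L, hL, a, ha, hLa⟩ := hardyMul_exists_log_approx hg hd (ε := min (ε / 10) (1 / 2))
    (by positivity) (min_le_right _ _)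
  obtain ⟨N, hN⟩ := eventually_atTop.1 (hr.eventually_const_lt ha)
  refine ⟨N, fun m hm n hn => ?_⟩
  have hi : ∀ n, CircleIntegrable (fun ζ => |Real.log ‖g (r n * ζ)‖ + L ζ|) 0 1 := fun n =>
    ((hc n).add hL).abs.circleIntegrable zero_le_one
  have hmin := min_le_left (ε / 10) (1 / 2)
  have h1 := hLa _ (hN m hm) (hr1 m)
  have h2 := hLa _ (hN n hn) (hr1 n)
  calc _ ≤ Real.circleAverage (fun ζ => |Real.log ‖g (r m * ζ)‖ + L ζ| +
        |Real.log ‖g (r n * ζ)‖ + L ζ|) 0 1 := by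
        refine Real.circleAverage_mono (((hc m).sub (hc n)).abs.circleIntegrable zero_le_one)
          ((hi m).add (hi n)) fun ζ _ => ?_
        refine le_trans (le_of_eq ?_) (abs_sub _ _)
        congr 1
        ring
    _ = _ := Real.circleAverage_fun_add (hi m) (hi n)
    _ ≤ ε := by linarith

/-- A bounded analytic function whose multiples are dense in `H²` is outer. -/
theorem isOuter_of_denseRange {g : ℂ → ℂ} (hg : IsHInfty g) (hd : DenseRange (hardyMul hg)) :
    IsOuter g := by
  have hne : ∀ z ∈ ball (0 : ℂ) 1, g z ≠ 0 := fun z hz => hardyMul_ne_zero hg hd hz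
  obtain ⟨r, hr0, hr1, hrt⟩ : ∃ r : ℕ → ℝ, (∀ n, 0 ≤ r n) ∧ (∀ n, r n < 1) ∧
      Tendsto r atTop (𝓝 1) := by
    obtain ⟨r, -, hr, hrt⟩ := exists_seq_strictMono_tendsto' (zero_lt_one (α := ℝ))
    exact ⟨r, fun n => (hr n).1.le, fun n => (hr n).2, hrt⟩
  obtain ⟨u, hu, hut⟩ := hardyMul_exists_log_boundary hg hd hr0 hr1 hrt
  have hre : ∀ z ∈ ball (0 : ℂ) 1, Real.log ‖g z‖ = (herglotzIntegral u z).re := by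
    intro z hz
    have hz' : ‖z‖ < 1 := by simpa using hz
    have hleft : Tendsto (fun n => Real.log ‖g (r n * z)‖) atTop (𝓝 (Real.log ‖g z‖)) := by
      have h1 : Tendsto (fun n => (r n : ℂ) * z) atTop (𝓝 z) := by
        simpa using ((Complex.continuous_ofReal.tendsto _).comp hrt).mul_const z
      have h2 := (hg.1.continuousOn.continuousAt (isOpen_ball.mem_nhds hz)).tendsto.comp h1
      exact h2.norm.log (norm_ne_zero_iff.2 (hne z hz))
    -- The function `log |g (r n * w)|` is harmonic near the closed disk. In its Poisson formula the
    -- limit may be taken on the right, as the kernel at `z` is bounded by `(1 + |z|) / (1 - |z|)`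
    -- and the boundary functions converge in `L¹`.
    have hpoisson : ∀ n, Real.log ‖g (r n * z)‖ =
        Real.circleAverage (fun ζ => ((ζ + z) / (ζ - z)).re * Real.log ‖g (r n * ζ)‖) 0 1 := by
      intro n
      have hh : InnerProductSpace.HarmonicOnNhd (fun w => Real.log ‖g (r n * w)‖)
          (closedBall 0 1) := by
        intro w hw
        have hb := ofReal_mul_mem_ball (hr0 n) (hr1 n) hw
        have hga : AnalyticAt ℂ (fun w => g (r n * w)) w :=
          AnalyticAt.fun_comp (hg.1.analyticAt (isOpen_ball.mem_nhds hb)) (by fun_prop)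
        exact hga.harmonicAt_log_norm (hne _ hb)
      have := hh.circleAverage_re_herglotzRieszKernel_smul hz
      rw [re_herglotzRieszKernel_smul] at this
      exact this.symm
    have hk : ContinuousOn (fun ζ : ℂ => ((ζ + z) / (ζ - z)).re) (sphere 0 |1|) :=
      Complex.continuous_re.comp_continuousOn (herglotz_continuousOn hz)
    have hright : Tendsto (fun n => Real.circleAverage
        (fun ζ => ((ζ + z) / (ζ - z)).re * Real.log ‖g (r n * ζ)‖) 0 1) atTop
        (𝓝 (herglotzIntegral u z).re) := by
      rw [herglotzIntegral_re hu hz, tendsto_iff_norm_sub_tendsto_zero]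
      refine squeeze_zero (fun _ => norm_nonneg _) (fun n => ?_)
        (by simpa using hut.const_mul ((1 + ‖z‖) / (1 - ‖z‖)))
      have hi : CircleIntegrable (fun ζ => Real.log ‖g (r n * ζ)‖) 0 1 :=
        (log_norm_dilate_continuousOn hg.1 hne (hr0 n) (hr1 n)).circleIntegrable zero_le_one
      have hd1 : CircleIntegrable (fun ζ => Real.log ‖g (r n * ζ)‖ - u ζ) 0 1 := hi.sub hu
      have hd2 : CircleIntegrable
          (fun ζ => ((ζ + z) / (ζ - z)).re * (Real.log ‖g (r n * ζ)‖ - u ζ)) 0 1 :=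
        hd1.continuousOn_smul hk
      have h3 := Real.circleAverage_fun_sub (hi.continuousOn_smul hk) (hu.continuousOn_smul hk)
      simp only [Pi.smul_apply', smul_eq_mul] at h3
      rw [Real.norm_eq_abs]
      have h4 : |Real.circleAverage
          (fun ζ => ((ζ + z) / (ζ - z)).re * (Real.log ‖g (r n * ζ)‖ - u ζ)) 0 1| ≤
          (1 + ‖z‖) / (1 - ‖z‖) *
            Real.circleAverage (fun ζ => |Real.log ‖g (r n * ζ)‖ - u ζ|) 0 1 := by
        refine Real.abs_circleAverage_le_circleAverage_abs.trans ?_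
        have h5 := Real.circleAverage_fun_smul (a := (1 + ‖z‖) / (1 - ‖z‖)) (c := 0) (R := 1)
          (f := fun ζ => |Real.log ‖g (r n * ζ)‖ - u ζ|)
        rw [smul_eq_mul] at h5
        rw [← h5]
        refine Real.circleAverage_mono hd2.abs (hd1.abs.const_smul) fun ζ hζ => ?_
        rw [abs_one] at hζ
        have h6 := re_herglotzRieszKernel_le hζ hz
        simp only [sub_zero] at h6
        simp only [Pi.abs_apply, abs_mul, smul_eq_mul]
        rw [abs_of_nonneg (herglotz_re_nonneg hz hζ)]
        exact mul_le_mul_of_nonneg_right h6 (abs_nonneg _)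
      refine le_trans (le_of_eq ?_) h4
      congr 1
      simp only [mul_sub]
      exact h3.symm
    refine tendsto_nhds_unique hleft ?_
    simpa only [hpoisson] using hright
  have hnorm : ∀ z ∈ ball (0 : ℂ) 1, ‖g z * Complex.exp (-herglotzIntegral u z)‖ = 1 := by
    intro z hz
    rw [norm_mul, Complex.norm_exp, Complex.neg_re, ← hre z hz, Real.exp_neg,
      Real.exp_log (norm_pos_iff.2 (hne z hz)), mul_inv_cancel₀ (norm_ne_zero_iff.2 (hne z hz))]
  -- An analytic function of constant modulus is constant; its value is the unimodular factor.
  have hconst := Complex.eqOn_of_isPreconnected_of_isMaxOn_norm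
    (f := fun z => g z * Complex.exp (-herglotzIntegral u z)) (c := 0)
    (convex_ball (0 : ℂ) 1).isPreconnected isOpen_ball
    (hg.1.mul (herglotzIntegral_differentiableOn hu).neg.cexp) (mem_ball_self one_pos)
    fun z hz => by
      change ‖_‖ ≤ ‖_‖
      rw [hnorm z hz, hnorm 0 (mem_ball_self one_pos)]
  refine ⟨_, u, hnorm 0 (mem_ball_self one_pos), hu, fun z hz => ?_⟩
  have h1 := hconst hz
  simp only [Function.const_apply] at h1
  rw [← h1, mul_assoc]
  change _ = g z * (_ * Complex.exp (herglotzIntegral u z))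
  rw [← Complex.exp_add, neg_add_cancel, Complex.exp_zero, mul_one]

/-! ### The model operator and its functional calculus. -/

section Model

variable {θ : ℂ → ℂ}

theorem modelProjection_eq_zero (f : Hardy2) (hf : f ∈ innerRange θ) :
    (modelSpace θ).orthogonalProjectionOnto f = 0 :=
  Submodule.orthogonalProjectionOnto_eq_zero_iff.2 (Submodule.le_orthogonal_orthogonal _ hf)

theorem sub_modelProjection_mem (hθ : IsInner θ) (f : Hardy2) :
    f - (modelSpace θ).orthogonalProjectionOnto f ∈ innerRange θ := by
  have := innerRange_hasOrthogonalProjection hθ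
  have h := (modelSpace θ).sub_starProjection_mem_orthogonal f
  rwa [Submodule.orthogonal_orthogonal] at h

theorem modelProjection_congr {f g : Hardy2} (h : f - g ∈ innerRange θ) :
    (modelSpace θ).orthogonalProjectionOnto f = (modelSpace θ).orthogonalProjectionOnto g := by
  rw [← sub_eq_zero, ← map_sub]
  exact modelProjection_eq_zero _ h

theorem eq_zero_of_mem_innerRange {k : modelSpace θ} (h : (k : Hardy2) ∈ innerRange θ) :
    k = 0 :=
  Subtype.ext (inner_self_eq_zero.1 (k.2 _ h) : (k : Hardy2) = 0)

/-- What a projection discards lies in `θH²`, which the shift preserves, so later projections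
discard it too. -/
theorem modelOperator_pow (hθ : IsInner θ) (n : ℕ) (x : modelSpace θ) :
    (modelOperator θ ^ n) x =
      (modelSpace θ).orthogonalProjectionOnto ((hardyShift ^ n) (x : Hardy2)) := by
  induction n with
  | zero => simp
  | succ n ih =>
    rw [pow_succ', mul_apply_eq_comp, ih, pow_succ', mul_apply_eq_comp]
    refine modelProjection_congr ?_
    rw [← neg_mem_iff, neg_sub]
    change hardyShift _ - hardyShift _ ∈ _
    rw [← map_sub]
    exact hardyShift_mem_innerRange (sub_modelProjection_mem hθ _)

/-- The functional calculus of the model operator: `g(T_θ)` is the compression of the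
multiplication by `g`. -/
theorem isHInftyCalculus_modelOperator_iff (hθ : IsInner θ) {g : ℂ → ℂ} (hg : IsHInfty g)
    (A : modelSpace θ →L[ℂ] modelSpace θ) :
    IsHInftyCalculus g (modelOperator θ) A ↔
      ∀ x : modelSpace θ, A x = (modelSpace θ).orthogonalProjectionOnto (hardyMul hg x) := by
  have key : ∀ x : modelSpace θ, Tendsto (fun r : ℝ => ∑' n : ℕ,
      ((n.factorial : ℂ)⁻¹ * iteratedDeriv n g 0 * (r : ℂ) ^ n) • (modelOperator θ ^ n) x)
      (𝓝[<] 1) (𝓝 ((modelSpace θ).orthogonalProjectionOnto (hardyMul hg x))) := by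
    intro x
    -- The projection is continuous and carries the Abel sums of the shift to those of `T_θ`.
    have h1 := ((modelSpace θ).orthogonalProjectionOnto.continuous.tendsto _).comp
      (hardy_calculus_tendsto hg (x : Hardy2))
    refine h1.congr' ?_
    filter_upwards [Ioo_mem_nhdsLT (zero_lt_one (α := ℝ))] with r hr
    obtain ⟨a, ha⟩ := hardy_of_isHInfty hg
    simp only [Function.comp_apply, hardy_taylorCoeff ha]
    rw [ContinuousLinearMap.map_tsum _ (hardy_calculus_summable a x hr.1.le hr.2)]
    refine tsum_congr fun n => ?_
    rw [map_smul, modelOperator_pow hθ]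
  constructor
  · exact fun h x => tendsto_nhds_unique (h x) (key x)
  · intro h x
    rw [h x]
    exact key x

theorem coe_modelOperator_add_modelCorner (hθ : IsInner θ) (k : modelSpace θ) :
    (modelOperator θ k : Hardy2) + modelCorner hθ k = hardyShift k := by
  have := innerRange_hasOrthogonalProjection hθ
  rw [add_comm]
  exact Submodule.starProjection_add_starProjection_orthogonal (K := innerRange θ) _

/-! ### The intertwining map from the extension to the shift. -/

variable {H : Type*} [NormedAddCommGroup H] [InnerProductSpace ℂ H]

/-- The operator `(I Z; 0 Y₀)` from `θH² ⊕ 𝓗` to `H² = θH² ⊕ 𝓚_θ`. -/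
noncomputable def extensionMap (Y₀ : H →L[ℂ] modelSpace θ) (Z : H →L[ℂ] innerRange θ) :
    WithLp 2 (innerRange θ × H) →L[ℂ] Hardy2 :=
  (innerRange θ).subtypeL ∘L
    (WithLp.fstL 2 ℂ (innerRange θ) H + Z ∘L WithLp.sndL 2 ℂ (innerRange θ) H) +
    (modelSpace θ).subtypeL ∘L Y₀ ∘L WithLp.sndL 2 ℂ (innerRange θ) H

theorem extensionMap_apply (Y₀ : H →L[ℂ] modelSpace θ) (Z : H →L[ℂ] innerRange θ)
    (w : WithLp 2 (innerRange θ × H)) :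
    extensionMap Y₀ Z w = ((w.fst + Z w.snd : innerRange θ) : Hardy2) + Y₀ w.snd := rfl

theorem modelExtension_fst (hθ : IsInner θ) (T₀ : H →L[ℂ] H) (Y₀ : H →L[ℂ] modelSpace θ)
    (Z : H →L[ℂ] innerRange θ) (w : WithLp 2 (innerRange θ × H)) :
    (modelExtension hθ T₀ Y₀ Z w).fst = shiftOnInnerRange θ w.fst +
      (shiftOnInnerRange θ (Z w.snd) - Z (T₀ w.snd) + modelCorner hθ (Y₀ w.snd)) := rfl

theorem modelExtension_snd (hθ : IsInner θ) (T₀ : H →L[ℂ] H) (Y₀ : H →L[ℂ] modelSpace θ)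
    (Z : H →L[ℂ] innerRange θ) (w : WithLp 2 (innerRange θ × H)) :
    (modelExtension hθ T₀ Y₀ Z w).snd = T₀ w.snd := rfl

theorem coe_shiftOnInnerRange (f : innerRange θ) :
    (shiftOnInnerRange θ f : Hardy2) = hardyShift f := rfl

/-- In `A`, the term `-Z T₀` cancels the contribution of the second component `T₀` through `Z`, and
`K_θ Y₀` supplies the part of `S` on `𝓚_θ` that falls into `θH²`. -/
theorem extensionMap_intertwines (hθ : IsInner θ) {T₀ : H →L[ℂ] H} {Y₀ : H →L[ℂ] modelSpace θ}
    (Z : H →L[ℂ] innerRange θ) (hY₀ : Y₀ ∘L T₀ = modelOperator θ ∘L Y₀)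
    (w : WithLp 2 (innerRange θ × H)) :
    extensionMap Y₀ Z (modelExtension hθ T₀ Y₀ Z w) = hardyShift (extensionMap Y₀ Z w) := by
  have h1 : Y₀ (T₀ w.snd) = modelOperator θ (Y₀ w.snd) := DFunLike.congr_fun hY₀ w.snd
  rw [extensionMap_apply, extensionMap_apply, modelExtension_fst, modelExtension_snd, h1, map_add,
    ← coe_modelOperator_add_modelCorner hθ (Y₀ w.snd)]
  simp only [Submodule.coe_add, Submodule.coe_sub, coe_shiftOnInnerRange, map_add]
  abel

/-- Modulo `θH²` only `Y₀ w.snd`, a vector of `𝓚_θ`, remains. -/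
theorem snd_eq_zero_of_extensionMap_mem {Y₀ : H →L[ℂ] modelSpace θ} {Z : H →L[ℂ] innerRange θ}
    (hY : LinearMap.ker (Y₀ : H →ₗ[ℂ] modelSpace θ) = ⊥) {w : WithLp 2 (innerRange θ × H)}
    (hw : extensionMap Y₀ Z w ∈ innerRange θ) : w.snd = 0 := by
  rw [extensionMap_apply, Submodule.add_mem_iff_right _ (SetLike.coe_mem _)] at hw
  exact LinearMap.ker_eq_bot'.1 hY _ (eq_zero_of_mem_innerRange hw)

theorem extensionMap_injective {Y₀ : H →L[ℂ] modelSpace θ} {Z : H →L[ℂ] innerRange θ}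
    (hY : LinearMap.ker (Y₀ : H →ₗ[ℂ] modelSpace θ) = ⊥) {w : WithLp 2 (innerRange θ × H)}
    (hw : extensionMap Y₀ Z w = 0) : w = 0 := by
  have h2 : w.snd = 0 := snd_eq_zero_of_extensionMap_mem (Z := Z) hY (by rw [hw]; exact zero_mem _)
  rw [extensionMap_apply, h2, map_zero, map_zero, add_zero, ZeroMemClass.coe_zero, add_zero] at hw
  have h1 : w.fst = 0 := Subtype.ext hw
  exact (WithLp.equiv 2 _).injective (Prod.ext h1 h2)

theorem extensionMap_denseRange (hθ : IsInner θ) {Y₀ : H →L[ℂ] modelSpace θ}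
    (Z : H →L[ℂ] innerRange θ) (hY : DenseRange Y₀) : DenseRange (extensionMap Y₀ Z) := by
  intro f
  set k := (modelSpace θ).orthogonalProjectionOnto f
  set n : innerRange θ := ⟨f - k, sub_modelProjection_mem hθ f⟩
  have hc : Continuous fun x : modelSpace θ => (n : Hardy2) + x := by fun_prop
  have := map_mem_closure hc (hY k) (t := Set.range (extensionMap Y₀ Z)) (by
    rintro _ ⟨h, rfl⟩
    -- Subtracting `Z h` in advance cancels the term that the map adds.
    refine ⟨WithLp.toLp 2 (n - Z h, h), ?_⟩
    rw [extensionMap_apply]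
    simp)
  simpa [n] using this

theorem extensionMap_isQuasiaffinity (hθ : IsInner θ) {Y₀ : H →L[ℂ] modelSpace θ}
    (Z : H →L[ℂ] innerRange θ) (hq : IsQuasiaffinity Y₀) :
    IsQuasiaffinity (extensionMap Y₀ Z) :=
  ⟨LinearMap.ker_eq_bot'.2 fun _ hw => extensionMap_injective hq.1 hw,
    extensionMap_denseRange hθ Z hq.2⟩

/-! ### Quasiaffinities from the shift to the extension. -/

/-- The compression to `𝓚_θ → 𝓗` of a quasiaffinity that intertwines the shift with the
extension. -/
theorem exists_of_shift_quasiaffineTransform (hθ : IsInner θ) {T₀ : H →L[ℂ] H}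
    {Y₀ : H →L[ℂ] modelSpace θ} {Z : H →L[ℂ] innerRange θ}
    (hY₀ : Y₀ ∘L T₀ = modelOperator θ ∘L Y₀) (hq : IsQuasiaffinity Y₀)
    (h : QuasiaffineTransform hardyShift (modelExtension hθ T₀ Y₀ Z)) :
    ∃ (X₀ : modelSpace θ →L[ℂ] H) (g : ℂ → ℂ), IsQuasiaffinity X₀ ∧ IsHInfty g ∧ IsOuter g ∧
      T₀ ∘L X₀ = X₀ ∘L modelOperator θ ∧
      IsHInftyCalculus g (modelOperator θ) (Y₀ ∘L X₀) := by
  obtain ⟨X, hX, hXS⟩ := h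
  have hXS' : ∀ f, X (hardyShift f) = modelExtension hθ T₀ Y₀ Z (X f) := DFunLike.congr_fun hXS
  obtain ⟨g, hg, hgB⟩ := exists_eq_hardyMul (B := extensionMap Y₀ Z ∘L X) fun f => by
    rw [ContinuousLinearMap.comp_apply, ContinuousLinearMap.comp_apply, hXS',
      extensionMap_intertwines hθ Z hY₀]
  have hgB' : ∀ f, extensionMap Y₀ Z (X f) = hardyMul hg f := DFunLike.congr_fun hgB
  have ho : IsOuter g := by
    refine isOuter_of_denseRange hg ?_
    rw [← hgB]
    exact (extensionMap_denseRange hθ Z hq.2).comp hX.2 (extensionMap Y₀ Z).continuous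
  set X₀ : modelSpace θ →L[ℂ] H :=
    WithLp.sndL 2 ℂ (innerRange θ) H ∘L X ∘L (modelSpace θ).subtypeL with hX₀
  have hX₀k : ∀ k : modelSpace θ, X₀ k = (X k).snd := fun _ => rfl
  have hN : ∀ f ∈ innerRange θ, (X f).snd = 0 := fun f hf =>
    snd_eq_zero_of_extensionMap_mem (Z := Z) hq.1 (by
      rw [hgB']; exact hardyMul_mem_innerRange hg hf)
  have hsnd : ∀ f, (X f).snd = X₀ ((modelSpace θ).orthogonalProjectionOnto f) := by
    intro f
    have := hN _ (sub_modelProjection_mem hθ f)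
    rw [map_sub, WithLp.sub_snd, sub_eq_zero] at this
    rw [this, hX₀k]
  refine ⟨X₀, g, ⟨LinearMap.ker_eq_bot'.2 fun k hk => ?_, ?_⟩, hg, ho, ?_, ?_⟩
  -- If the second component of `X k` vanishes, then `g k` is in `θH²`; since `g` is outer, so is
  -- `k`, which is orthogonal to `θH²`.
  · refine eq_zero_of_mem_innerRange (ho.mem_innerRange hg hθ ?_)
    have hk' : (X k).snd = 0 := hk
    rw [← hgB', extensionMap_apply, hk', map_zero, map_zero, ZeroMemClass.coe_zero, add_zero]
    exact SetLike.coe_mem _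
  · have hs : Function.Surjective (WithLp.sndL 2 ℂ (innerRange θ) H) :=
      fun y => ⟨WithLp.toLp 2 (0, y), rfl⟩
    have hd := hs.denseRange.comp hX.2 (WithLp.sndL 2 ℂ (innerRange θ) H).continuous
    refine hd.mono ?_
    rintro _ ⟨f, rfl⟩
    exact ⟨_, (hsnd f).symm⟩
  · ext1 k
    have := congrArg WithLp.snd (hXS' (k : Hardy2))
    rw [hsnd, modelExtension_snd] at this
    exact this.symm
  · rw [isHInftyCalculus_modelOperator_iff hθ hg]
    intro k
    rw [← hgB', extensionMap_apply, map_add, modelProjection_eq_zero _ (SetLike.coe_mem _), zero_add,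
      Submodule.orthogonalProjectionOnto_mem_subspace_eq_self]
    rfl

/-- A quasiaffinity that intertwines the shift with the extension, built from one on the model
space. -/
theorem shift_quasiaffineTransform (hθ : IsInner θ) {T₀ : H →L[ℂ] H}
    {Y₀ : H →L[ℂ] modelSpace θ} {Z : H →L[ℂ] innerRange θ}
    (hY₀ : Y₀ ∘L T₀ = modelOperator θ ∘L Y₀) (hq : IsQuasiaffinity Y₀)
    {X₀ : modelSpace θ →L[ℂ] H} {g : ℂ → ℂ} (hX₀ : IsQuasiaffinity X₀) (hg : IsHInfty g)
    (ho : IsOuter g) (hc : IsHInftyCalculus g (modelOperator θ) (Y₀ ∘L X₀)) :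
    QuasiaffineTransform hardyShift (modelExtension hθ T₀ Y₀ Z) := by
  have := innerRange_hasOrthogonalProjection hθ
  rw [isHInftyCalculus_modelOperator_iff hθ hg] at hc
  have hdg := ho.denseRange_hardyMul hg
  set P := (modelSpace θ).orthogonalProjectionOnto with hP
  -- The second component is `X₀` applied to the class modulo `θH²`; the first is then forced by the
  -- requirement that `extensionMap Y₀ Z` send `X f` to `g f`.
  obtain ⟨X, hX⟩ : ∃ X : Hardy2 →L[ℂ] WithLp 2 (innerRange θ × H), ∀ f, X f = WithLp.toLp 2
      ((innerRange θ).orthogonalProjectionOnto (hardyMul hg f) - Z (X₀ (P f)), X₀ (P f)) :=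
    ⟨(WithLp.prodContinuousLinearEquiv 2 ℂ (innerRange θ) H).symm ∘L
      (((innerRange θ).orthogonalProjectionOnto ∘L hardyMul hg - Z ∘L X₀ ∘L P).prod (X₀ ∘L P)),
      fun _ => rfl⟩
  have hPf : ∀ f, Y₀ (X₀ (P f)) = P (hardyMul hg f) := by
    intro f
    refine (hc (P f)).trans (modelProjection_congr ?_)
    rw [← map_sub, ← neg_mem_iff, ← map_neg, neg_sub]
    exact hardyMul_mem_innerRange hg (sub_modelProjection_mem hθ f)
  have hYX : ∀ f, extensionMap Y₀ Z (X f) = hardyMul hg f := by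
    intro f
    rw [extensionMap_apply, hX]
    change ((_ - Z (X₀ (P f)) + Z (X₀ (P f)) : innerRange θ) : Hardy2) + Y₀ (X₀ (P f)) = _
    rw [sub_add_cancel, hPf]
    exact Submodule.starProjection_add_starProjection_orthogonal (K := innerRange θ) _
  refine ⟨X, ⟨LinearMap.ker_eq_bot'.2 fun f hf => ?_, ?_⟩, ?_⟩
  · have h1 := hYX f
    rw [show X f = 0 from hf, map_zero] at h1
    refine hardyEval_ext fun z hz => ?_
    have h2 := hardyEval_mul hg f hz
    have h0 : hardyEval 0 z = 0 := by simp [hardyEval]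
    rw [← h1, h0, eq_comm, mul_eq_zero] at h2
    rw [h0, h2.resolve_left (hardyMul_ne_zero hg hdg hz)]
  · set R := (LinearMap.range (X : Hardy2 →ₗ[ℂ] WithLp 2 (innerRange θ × H))).topologicalClosure
      with hR
    have hmem : ∀ f, X f ∈ R := fun f => Submodule.le_topologicalClosure _ ⟨f, rfl⟩
    have hXN : ∀ n : innerRange θ, X n = WithLp.toLp 2
        (⟨hardyMul hg n, hardyMul_mem_innerRange hg n.2⟩, 0) := by
      intro n
      rw [hX, hP, modelProjection_eq_zero _ n.2, map_zero, map_zero, sub_zero]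
      congr 2
      exact Submodule.orthogonalProjectionOnto_mem_subspace_eq_self
        (⟨hardyMul hg n, hardyMul_mem_innerRange hg n.2⟩ : innerRange θ)
    -- On `θH²` the operator `X` is multiplication by `g`, so it sends `θ f'` to `θ g f'`; density
    -- of `g H²` then gives all of `θH² ⊕ 0`.
    have hfst : ∀ a : innerRange θ, (WithLp.toLp 2 (a, 0) : WithLp 2 (innerRange θ × H)) ∈ R := by
      rintro ⟨a, f, hf⟩
      let M : Hardy2 →L[ℂ] innerRange θ := (hardyMul hθ.1).codRestrict (innerRange θ)
        fun f => ⟨f, fun z hz => hardyEval_mul hθ.1 f hz⟩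
      have hcont : Continuous fun f =>
          (WithLp.toLp 2 (M f, 0) : WithLp 2 (innerRange θ × H)) := by fun_prop
      have h1 := map_mem_closure hcont (hdg f)
        (t := LinearMap.range (X : Hardy2 →ₗ[ℂ] WithLp 2 (innerRange θ × H))) (by
          rintro _ ⟨f', rfl⟩
          refine ⟨(M f' : Hardy2), ?_⟩
          refine (hXN (M f')).trans ?_
          congr 2
          exact Subtype.ext (hardyMul_comm hg hθ.1 f'))
      have h2 : M f = ⟨a, f, hf⟩ := Subtype.ext (hardyMul_eq hθ.1 hf)
      rw [h2] at h1
      exact h1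
    -- Removing from `X k` its first component, already in `R`, leaves `X₀ k`, and these vectors are
    -- dense.
    have hsnd : ∀ h : H, (WithLp.toLp 2 (0, h) : WithLp 2 (innerRange θ × H)) ∈ R := by
      intro h
      have hcont : Continuous fun h : H =>
          (WithLp.toLp 2 (0, h) : WithLp 2 (innerRange θ × H)) := by fun_prop
      have h1 := map_mem_closure hcont (hX₀.2 h) (t := R) (by
        rintro _ ⟨k, rfl⟩
        have h2 := R.sub_mem (hmem (k : Hardy2)) (hfst (X (k : Hardy2)).fst)
        convert h2 using 1
        rw [hX, hP, Submodule.orthogonalProjectionOnto_mem_subspace_eq_self]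
        simp [← WithLp.toLp_sub])
      exact (LinearMap.range
        (X : Hardy2 →ₗ[ℂ] WithLp 2 (innerRange θ × H))).isClosed_topologicalClosure.closure_subset h1
    intro w
    have h3 := R.add_mem (hfst w.fst) (hsnd w.snd)
    rw [← WithLp.toLp_add, Prod.mk_add_mk, add_zero, zero_add] at h3
    exact h3
  · ext1 f
    -- The relation may be checked after applying the injective `extensionMap Y₀ Z`, where it says
    -- that `g` commutes with the shift.
    rw [← sub_eq_zero]
    refine extensionMap_injective (Z := Z) hq.1 ?_
    rw [map_sub, ContinuousLinearMap.comp_apply, ContinuousLinearMap.comp_apply, hYX,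
      extensionMap_intertwines hθ Z hY₀, hYX, hardyMul_shift, sub_self]

end Model

theorem proposition2p4 {θ : ℂ → ℂ} (hθ : IsInner θ)
    {H : Type*} [NormedAddCommGroup H] [InnerProductSpace ℂ H] [CompleteSpace H]
    (T₀ : H →L[ℂ] H) (Y₀ : H →L[ℂ] modelSpace θ) (Z : H →L[ℂ] innerRange θ)
    (hY₀ : Y₀ ∘L T₀ = modelOperator θ ∘L Y₀) (hq : IsQuasiaffinity Y₀) :
    Quasisimilar (modelExtension hθ T₀ Y₀ Z) hardyShift ↔
      ∃ (X₀ : modelSpace θ →L[ℂ] H) (g : ℂ → ℂ),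
        IsQuasiaffinity X₀ ∧ IsHInfty g ∧ IsOuter g ∧
          T₀ ∘L X₀ = X₀ ∘L modelOperator θ ∧
          IsHInftyCalculus g (modelOperator θ) (Y₀ ∘L X₀) := by
  constructor
  · exact fun h => exists_of_shift_quasiaffineTransform hθ hY₀ hq h.2
  · rintro ⟨X₀, g, hX₀, hg, ho, -, hc⟩
    exact ⟨⟨extensionMap Y₀ Z, extensionMap_isQuasiaffinity hθ Z hq,
      ContinuousLinearMap.ext fun w => extensionMap_intertwines hθ Z hY₀ w⟩,
      shift_quasiaffineTransform hθ hY₀ hq hX₀ hg ho hc⟩
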